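/- A halfspace on $\mathbb{R}^M$ is a function $f(x)=\mathrm{sign}(w\cdot x-\theta)$ with $w\in\mathbb{R}^M$, $\theta\in\mathbb{R}$, where $\mathrm{sign}(t)=1$ if $t\ge 0$ and $-1$ otherwise. For $0<\eta<1/2$, a distribution $D$ on $\mathbb{R}^M\times\{\pm1\}$ is a *halfspace with $\eta$-Massart noise* if there are a probability distribution $D_x$ on $\mathbb{R}^M$, a halfspace $f$ and a measurable $\eta(\cdot):\mathbb{R}^M\to[0,\eta]$ such that $(x,y)\sim D$ is generated by drawing $x\sim D_x$ and then letting $y=f(x)$ with probability $1-\eta(x)$ and $y=-f(x)$ with probability $\eta(x)$. The optimal error of $D$ is $\inf_g \Pr_{(x,y)\sim D}[g(x)\ne y]$ over all halfspaces $g$. An SQ algorithm using at most $q$ queries of tolerance $\tau$ is a (possibly randomized) procedure that adaptively asks at most $q$ queries, each a measurable function $\phi:\mathbb{R}^M\times\{\pm1\}\to[-1,1]$. Each query is answered by an oracle $\mathrm{STAT}(\tau)$, i.e. a function that assigns to every query $\phi$ an arbitrary value in $[\mathbf{E}_D\phi-\tau,\ \mathbf{E}_D\phi+\tau]$. The algorithm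 finally outputs an arbitrary measurable hypothesis $h:\mathbb{R}^M\to\{\pm1\}$ (improper learning is allowed). It learns a class of distributions to error better than $\varepsilon$ if, for every $D$ in the class and every such oracle, it outputs with probability at least $2/3$ over its internal randomness a hypothesis $h$ with $\Pr_{(x,y)\sim D}[h(x)\ne y]<\varepsilon$. **Theorem.** There are universal constants $K,c_0,c_1>0$ such that the following holds. Let $M$ be a positive integer and let $0<\mathrm{OPT}<\eta<1/2$ be such that $$\frac{\log M}{(\log\log M)^3}\ \ge\ K\log(1/\mathrm{OPT}),$$ and put $$\tau = M^{-c_0\left(\frac{\log M}{(\log\log M)^3}\right)/\log(1/\mathrm{OPT})}.$$ Then no SQ algorithm using at most $1/\tau$ queries of tolerance $\tau$ learns the class of halfspaces on $\mathbb{R}^M$ with $\eta$-Massart noise to error better than $c_1\eta$, even when it is only required to succeed on those distributions whose optimal error is at most $\mathrm{OPT}$. -/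

import Mathlib

open MeasureTheory

noncomputable section

/- Labels are the two units `1, -1` of `ℤ`; every set of labels is measurable. -/
instance instDiscreteLabels : DiscreteMeasurableSpace ℤˣ where
  forall_measurableSet s :=
    ⟨Units.val '' s, trivial, Set.preimage_image_eq s Units.val_injective⟩

/-- Labeled examples `(x, y)` with `x ∈ ℝ^M` and `y ∈ {1, -1}`. -/
abbrev Example (M : ℕ) : Type := (Fin M → ℝ) × ℤˣ

/-- `sign t = 1` if `t ≥ 0`, and `sign t = -1` otherwise. -/
def signLabel (t : ℝ) : ℤˣ := if 0 ≤ t then 1 else -1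

/-- Halfspaces on `ℝ^M`: functions of the form `x ↦ sign (w · x - θ)`. -/
def IsHalfspace {M : ℕ} (f : (Fin M → ℝ) → ℤˣ) : Prop :=
  ∃ (w : Fin M → ℝ) (θ : ℝ), ∀ x, f x = signLabel (dotProduct w x - θ)

/-- The law of `(x, y)` where `x ∼ Dx` and, given `x`, the label `y` is `f x` with probability
`1 - ρ x` and `-f x` with probability `ρ x`. -/
def noisyLaw {M : ℕ} (Dx : Measure (Fin M → ℝ)) (f : (Fin M → ℝ) → ℤˣ)
    (ρ : (Fin M → ℝ) → ℝ) : Measure (Example M) :=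
  (Dx.withDensity fun x => ENNReal.ofReal (1 - ρ x)).map (fun x => (x, f x)) +
    (Dx.withDensity fun x => ENNReal.ofReal (ρ x)).map (fun x => (x, -f x))

/-- `D` is the law of the labeled examples of a halfspace with Massart noise of rate at most `η`,
for some marginal distribution, some target halfspace and some noise function. -/
def IsMassartHalfspace {M : ℕ} (η : ℝ) (D : Measure (Example M)) : Prop :=
  ∃ (Dx : Measure (Fin M → ℝ)) (f : (Fin M → ℝ) → ℤˣ) (ρ : (Fin M → ℝ) → ℝ),
    IsProbabilityMeasure Dx ∧ IsHalfspace f ∧ Measurable ρ ∧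
    (∀ x, 0 ≤ ρ x ∧ ρ x ≤ 1 / 2 ∧ ρ x ≤ η) ∧ D = noisyLaw Dx f ρ

/-- Misclassification error of `h` under `D`. -/
def misclassification {M : ℕ} (D : Measure (Example M)) (h : (Fin M → ℝ) → ℤˣ) : ENNReal :=
  D {z | h z.1 ≠ z.2}

/-- Optimal misclassification error of a halfspace under `D`. -/
def optError {M : ℕ} (D : Measure (Example M)) : ENNReal :=
  ⨅ (g : (Fin M → ℝ) → ℤˣ) (_ : IsHalfspace g), misclassification D g

/-- Statistical queries: measurable functions of the labeled example with values in `[-1, 1]`. -/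
structure SQuery (M : ℕ) : Type where
  toFun : Example M → ℝ
  measurable : Measurable toFun
  mem_Icc : ∀ z, toFun z ∈ Set.Icc (-1 : ℝ) 1

/-- Hypotheses that a learner may output (arbitrary, not only halfspaces). -/
structure Hypothesis (M : ℕ) : Type where
  toFun : (Fin M → ℝ) → ℤˣ
  measurable : Measurable toFun

/-- Deterministic adaptive SQ algorithms: either output a hypothesis, or ask a query and continue
in a way that depends on the answer. -/
inductive SQAlgorithm (M : ℕ) : Type where
  | output (h : Hypothesis M) : SQAlgorithm M
  | query (f : SQuery M) (next : ℝ → SQAlgorithm M) : SQAlgorithm M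

namespace SQAlgorithm

/-- At most `q` queries are made, whatever the answers are. -/
def QueriesAtMost {M : ℕ} : SQAlgorithm M → ℕ → Prop
  | output _, _ => True
  | query _ _, 0 => False
  | query _ next, q + 1 => ∀ a : ℝ, (next a).QueriesAtMost q

/-- The hypothesis that is output when the query `f` is answered by `O f`. -/
def run {M : ℕ} (O : SQuery M → ℝ) : SQAlgorithm M → Hypothesis M
  | output h => h
  | query f next => (next (O f)).run O

end SQAlgorithm

/-- `O` is a valid `STAT(τ)` oracle for `D`: its answers are within `τ` of the expectations. -/
def IsSTATOracle {M : ℕ} (D : Measure (Example M)) (τ : ℝ) (O : SQuery M → ℝ) : Prop :=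
  ∀ f : SQuery M, O f ∈ Set.Icc ((∫ z, f.toFun z ∂D) - τ) ((∫ z, f.toFun z ∂D) + τ)

/-- A randomized SQ algorithm, given as a family `A` of deterministic ones indexed by a random seed
`ω ∼ μ`, learns halfspaces with `η`-Massart noise to error better than `err`, from queries of
tolerance `τ`, on all instances whose optimal error is at most `opt`: for every such instance and
every valid oracle, the output has error less than `err` with probability at least `2 / 3`
(the inner probability, so that no measurability in the seed has to be imposed). -/
def LearnsMassartHalfspaces {M : ℕ} {Ω : Type*} [MeasurableSpace Ω] (μ : Measure Ω)
    (A : Ω → SQAlgorithm M) (η opt τ err : ℝ) : Prop :=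
  ∀ D : Measure (Example M), IsMassartHalfspace η D → optError D ≤ ENNReal.ofReal opt →
    ∀ O : SQuery M → ℝ, IsSTATOracle D τ O →
      ∃ S : Set Ω, MeasurableSet S ∧ 2 / 3 ≤ μ S ∧
        ∀ ω ∈ S, misclassification D ((A ω).run O).toFun < ENNReal.ofReal err

end

namespace MassartSQ
open scoped BigOperators
open Finset

/-! The hard instances live on the uniform cube of bit arrays indexed by `Fin n × ZMod q`, mapped to
`ℝ^M` by monomials of degree at most `d`. Each word `v : Fin n → ZMod q` hides one instance: all its
densities depend on `x` only through `weight v x`. Label `-1` has total mass `η / 16` and density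
proportional to the indicator of `4 ∣ w`. Label `1` has the remaining mass and density proportional
to a profile `a` that vanishes on the set `Z` of multiples of `4` near `n / 2` and equals `1` at the
other multiples of `4`. Hence the labels are deterministic except at the multiples of `4` outside
`Z`, where `-1` has conditional probability at most `η`. The polynomial `sievePoly Z` in the weight
is negative exactly on `Z`, so its sign is a halfspace in the features. This is a Massart instance
whose halfspace errs only on the tail of the weight (`exists_instance`).

Both profiles are `1` plus a combination of powers `ζ ^ w` with `‖1 + ζ‖ ≤ √2` (`HighFrequency`).
Over independent bits such a power averages to `((1 + ζ) / 2) ^ n`, and the profiles of two words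
`u`, `v` have correlation of order `2 ^ (-hammingDist u v)`. The profile `a` comes from orthogonal
projection onto sampled exponentials (`exists_profile`); Reed-Solomon words (`exists_code`) are
pairwise far apart.

By a second moment bound (`card_correlated_le`), every query has, for all but `O(1 / τ ^ 2)` words,
nearly the same expectation as in the reference law where the label is independent of `x`. An oracle
giving the reference answers therefore reveals nothing about most words (`not_learns_of_family`),
and against the reference law every hypothesis errs with probability at least `η / 16`. The
parameters are balanced in `exists_params`. -/

/-- The number of ones that the bit array `x` has at the places selected by `v`. -/
def weight {n : ℕ} {κ : Type*} (v : Fin n → κ) (x : Fin n × κ → Bool) : ℕ :=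
  ∑ i, (x (i, v i)).toNat

/-! ### Averages of powers of the weight over the cube. -/

lemma expect_cube_prod {ι K : Type*} [Fintype ι] [DecidableEq ι] [Field K] [CharZero K]
    (f : ι → Bool → K) :
    𝔼 x : ι → Bool, ∏ c, f c (x c) = ∏ c, (f c false + f c true) / 2 := by
  rw [Fintype.expect_eq_sum_div_card, Finset.prod_div_distrib, ← Fintype.prod_sum]
  simp [Fintype.card_pi, add_comm]

lemma pow_weight_eq_prod {n : ℕ} {κ K : Type*} [Fintype κ] [DecidableEq κ] [CommMonoid K]
    (v : Fin n → κ) (x : Fin n × κ → Bool) (ζ : K) :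
    ζ ^ weight v x = ∏ c : Fin n × κ, if v c.1 = c.2 then ζ ^ (x c).toNat else 1 := by
  rw [weight, ← Finset.prod_pow_eq_pow_sum, Fintype.prod_prod_type]
  simp

lemma expect_pow_weight {n : ℕ} {κ K : Type*} [Fintype κ] [DecidableEq κ] [Field K] [CharZero K]
    (v : Fin n → κ) (ζ : K) :
    𝔼 x : Fin n × κ → Bool, ζ ^ weight v x = ((1 + ζ) / 2) ^ n := by
  have h := expect_cube_prod (fun (c : Fin n × κ) (b : Bool) =>
    if v c.1 = c.2 then ζ ^ b.toNat else 1)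
  simp only [pow_weight_eq_prod]
  rw [h, Fintype.prod_prod_type]
  have : ∀ (i : Fin n) (k : κ), ((if v i = k then ζ ^ false.toNat else 1) +
      (if v i = k then ζ ^ true.toNat else 1)) / 2 = if v i = k then (1 + ζ) / 2 else 1 := by
    intro i k
    split_ifs
    · simp
    · norm_num
  simp only [this, Finset.prod_ite_eq, Finset.mem_univ, if_true, Finset.prod_const,
    Finset.card_univ, Fintype.card_fin]

/-- The expectation factors over bits. At a place where `u` and `v` agree, one bit contributes `(1 +
ζ * ξ) / 2`, of norm at most `1`; where they differ, two independent bits contribute `(1 + ζ) / 2`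
and `(1 + ξ) / 2`, with product of norm at most `1 / 2`. -/
lemma norm_expect_pow_weight_mul_le {n : ℕ} {κ : Type*} [Fintype κ] [DecidableEq κ]
    (u v : Fin n → κ) {ζ ξ : ℂ} (hζ : ‖ζ‖ ≤ 1) (hξ : ‖ξ‖ ≤ 1)
    (hζ' : ‖1 + ζ‖ ≤ √2) (hξ' : ‖1 + ξ‖ ≤ √2) :
    ‖𝔼 x : Fin n × κ → Bool, ζ ^ weight u x * ξ ^ weight v x‖ ≤ (1 / 2) ^ hammingDist u v := by
  have h := expect_cube_prod (fun (c : Fin n × κ) (b : Bool) =>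
    (if u c.1 = c.2 then ζ ^ b.toNat else 1) * if v c.1 = c.2 then ξ ^ b.toNat else 1)
  simp only [pow_weight_eq_prod, ← Finset.prod_mul_distrib]
  rw [h, Fintype.prod_prod_type, norm_prod]
  -- The bound is written symmetrically in `u` and `v`, so that the product over `k` is `r i ^ 2` in
  -- both cases.
  set r : Fin n → ℝ := fun i => if u i = v i then 1 else √2 / 2 with hr
  have h2 : √2 * √2 = 2 := Real.mul_self_sqrt (by norm_num)
  have key : ∀ (i : Fin n) (k : κ),
      ‖(((if u i = k then ζ ^ false.toNat else 1) * if v i = k then ξ ^ false.toNat else 1) +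
      ((if u i = k then ζ ^ true.toNat else 1) * if v i = k then ξ ^ true.toNat else 1)) / 2‖ ≤
      (if u i = k then r i else 1) * if v i = k then r i else 1 := by
    intro i k
    simp only [hr]
    by_cases h1 : u i = k <;> by_cases h2 : v i = k
    · have : ‖1 + ζ * ξ‖ ≤ 2 := by
        refine (norm_add_le _ _).trans ?_
        rw [norm_mul, norm_one]
        nlinarith [norm_nonneg ζ, norm_nonneg ξ]
      simp [h1, h2]
      linarith
    · have h3 : k ≠ v i := fun h => h2 h.symm
      simp [h1, h2, h3]
      linarith
    · simp [h1, h2]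
      linarith
    · simp [h1, h2]
  calc ∏ i, ‖∏ k, (((if u i = k then ζ ^ false.toNat else 1) *
          if v i = k then ξ ^ false.toNat else 1) +
        ((if u i = k then ζ ^ true.toNat else 1) * if v i = k then ξ ^ true.toNat else 1)) / 2‖
      ≤ ∏ i, ∏ k, ((if u i = k then r i else 1) * if v i = k then r i else 1) := by
        refine Finset.prod_le_prod (fun i _ => norm_nonneg _) fun i _ => ?_
        rw [norm_prod]
        exact Finset.prod_le_prod (fun k _ => norm_nonneg _) fun k _ => key i k
    _ = ∏ i, (if u i ≠ v i then (1 / 2 : ℝ) else 1) := by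
        refine Finset.prod_congr rfl fun i _ => ?_
        rw [Finset.prod_mul_distrib]
        simp only [Finset.prod_ite_eq, Finset.mem_univ, if_true, hr]
        by_cases huv : u i = v i
        · simp [huv]
        · simp only [huv, if_false, ne_eq, not_false_eq_true, if_true]
          linarith
    _ = _ := by
        rw [Finset.prod_ite]
        simp [hammingDist]

/-- `F - 1` is a combination, with coefficients of total size `C`, of powers `ζ ^ w` of unit complex
numbers `ζ` away from `1`. -/
def HighFrequency (F : ℕ → ℝ) (C : ℝ) : Prop :=
  ∃ (J : Type) (_ : Fintype J) (c ζ : J → ℂ), (∀ w, (F w : ℂ) = 1 + ∑ j, c j * ζ j ^ w) ∧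
    (∀ j, ‖ζ j‖ ≤ 1) ∧ (∀ j, ‖1 + ζ j‖ ≤ √2) ∧ ∑ j, ‖c j‖ ≤ C

lemma HighFrequency.abs_expect_sub_one_le {F : ℕ → ℝ} {C : ℝ} (hF : HighFrequency F C)
    {n : ℕ} {κ : Type*} [Fintype κ] [DecidableEq κ] (v : Fin n → κ) :
    |𝔼 x, F (weight v x) - 1| ≤ C * (√2 / 2) ^ n := by
  obtain ⟨J, _, c, ζ, hF, h1, h2, hC⟩ := hF
  have e : ((𝔼 x, F (weight v x) - 1 : ℝ) : ℂ) = ∑ j, c j * ((1 + ζ j) / 2) ^ n := by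
    have : ((𝔼 x, F (weight v x) : ℝ) : ℂ) = 𝔼 x, (F (weight v x) : ℂ) := by
      simp [Fintype.expect_eq_sum_div_card]
    rw [Complex.ofReal_sub, this]
    simp only [hF, Finset.expect_add_distrib, Finset.expect_sum_comm, ← Finset.mul_expect,
      expect_pow_weight, Fintype.expect_const]
    simp
  rw [← Real.norm_eq_abs, ← Complex.norm_real, e]
  calc ‖∑ j, c j * ((1 + ζ j) / 2) ^ n‖ ≤ ∑ j, ‖c j‖ * (√2 / 2) ^ n := by
        refine (norm_sum_le _ _).trans (Finset.sum_le_sum fun j _ => ?_)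
        rw [norm_mul, norm_pow, norm_div]
        have := h2 j
        gcongr
        simp
    _ = (∑ j, ‖c j‖) * (√2 / 2) ^ n := by rw [Finset.sum_mul]
    _ ≤ _ := by gcongr

lemma HighFrequency.abs_expect_mul_le {F : ℕ → ℝ} {C : ℝ} (hF : HighFrequency F C)
    {n : ℕ} {κ : Type*} [Fintype κ] [DecidableEq κ] (u v : Fin n → κ) :
    |𝔼 x, (F (weight u x) - 1) * (F (weight v x) - 1)| ≤ C ^ 2 * (1 / 2) ^ hammingDist u v := by
  obtain ⟨J, _, c, ζ, hF, h1, h2, hC⟩ := hF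
  have e : ((𝔼 x, (F (weight u x) - 1) * (F (weight v x) - 1) : ℝ) : ℂ) =
      ∑ i, ∑ j, c i * c j * 𝔼 x, ζ i ^ weight u x * ζ j ^ weight v x := by
    have : ((𝔼 x, (F (weight u x) - 1) * (F (weight v x) - 1) : ℝ) : ℂ) =
        𝔼 x, ((F (weight u x) : ℂ) - 1) * ((F (weight v x) : ℂ) - 1) := by
      simp [Fintype.expect_eq_sum_div_card]
    rw [this]
    simp only [hF, add_sub_cancel_left, Finset.mul_expect, ← Finset.expect_sum_comm]
    refine Finset.expect_congr rfl fun x _ => ?_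
    rw [Finset.sum_mul_sum]
    exact Finset.sum_congr rfl fun i _ => Finset.sum_congr rfl fun j _ => by ring
  rw [← Real.norm_eq_abs, ← Complex.norm_real, e]
  calc ‖∑ i, ∑ j, c i * c j * 𝔼 x, ζ i ^ weight u x * ζ j ^ weight v x‖
      ≤ ∑ i, ∑ j, ‖c i‖ * ‖c j‖ * (1 / 2) ^ hammingDist u v := by
        refine (norm_sum_le _ _).trans (Finset.sum_le_sum fun i _ => ?_)
        refine (norm_sum_le _ _).trans (Finset.sum_le_sum fun j _ => ?_)
        rw [norm_mul, norm_mul]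
        gcongr
        exact norm_expect_pow_weight_mul_le u v (h1 i) (h1 j) (h2 i) (h2 j)
    _ = (∑ j, ‖c j‖) ^ 2 * (1 / 2) ^ hammingDist u v := by
        rw [sq, Finset.sum_mul_sum, Finset.sum_mul]
        exact Finset.sum_congr rfl fun i _ => by rw [Finset.sum_mul]
    _ ≤ _ := by
        have : 0 ≤ ∑ j, ‖c j‖ := Finset.sum_nonneg fun j _ => norm_nonneg _
        gcongr

/-- The part of the cube where the weight is far from `n / 2` is small. -/
lemma expect_weight_tail_le {n : ℕ} (hn : 0 < n) {κ : Type*} [Fintype κ] [DecidableEq κ]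
    (v : Fin n → κ) {L : ℝ} (hL : 0 ≤ L) :
    (𝔼 x, if L < |(weight v x : ℝ) - n / 2| then (1 : ℝ) else 0) ≤
      2 * Real.exp (-(2 * L ^ 2 / n)) := by
  have hn' : (0 : ℝ) < n := by exact_mod_cast hn
  have mgf : ∀ s : ℝ, 𝔼 x, Real.exp (s * (weight v x - n / 2)) ≤ Real.exp (n * s ^ 2 / 8) := by
    intro s
    have e : ∀ x, Real.exp (s * (weight v x - n / 2)) =
        Real.exp (-s / 2) ^ n * Real.exp s ^ weight v x := by
      intro x
      rw [← Real.exp_nat_mul, ← Real.exp_nat_mul, ← Real.exp_add]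
      congr 1; ring
    simp only [e, ← Finset.mul_expect, expect_pow_weight]
    rw [← mul_pow]
    have : Real.exp (-s / 2) * ((1 + Real.exp s) / 2) = Real.cosh (s / 2) := by
      rw [Real.cosh_eq, mul_div_assoc', mul_add, mul_one, ← Real.exp_add]
      ring_nf
    rw [this]
    calc Real.cosh (s / 2) ^ n ≤ Real.exp ((s / 2) ^ 2 / 2) ^ n := by
          gcongr
          exact Real.cosh_le_exp_half_sq _
      _ = _ := by rw [← Real.exp_nat_mul]; congr 1; ring
  -- The Chernoff exponent minimizing `n * s ^ 2 / 8 - s * L`.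
  set s : ℝ := 4 * L / n with hs
  have hs0 : 0 ≤ s := by positivity
  have pt : ∀ x : Fin n × κ → Bool,
      (if L < |(weight v x : ℝ) - n / 2| then (1 : ℝ) else 0) ≤
      Real.exp (-(s * L)) * Real.exp (s * (weight v x - n / 2)) +
        Real.exp (-(s * L)) * Real.exp (-s * (weight v x - n / 2)) := by
    intro x
    rw [← Real.exp_add, ← Real.exp_add]
    split_ifs with h
    · rcases lt_abs.mp h with h | h
      · have : 1 ≤ Real.exp (-(s * L) + s * (weight v x - n / 2)) :=
          Real.one_le_exp (by nlinarith)
        have := Real.exp_pos (-(s * L) + -s * (weight v x - n / 2))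
        linarith
      · have : 1 ≤ Real.exp (-(s * L) + -s * (weight v x - n / 2)) :=
          Real.one_le_exp (by nlinarith)
        have := Real.exp_pos (-(s * L) + s * (weight v x - n / 2))
        linarith
    · positivity
  refine (Finset.expect_le_expect fun x _ => pt x).trans ?_
  rw [Finset.expect_add_distrib, ← Finset.mul_expect, ← Finset.mul_expect]
  have e : Real.exp (-(2 * L ^ 2 / n)) = Real.exp (-(s * L)) * Real.exp (n * s ^ 2 / 8) := by
    rw [← Real.exp_add]; congr 1; rw [hs]; field_simp; ring
  have h1 := mgf s
  have h2 := mgf (-s)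
  rw [neg_sq] at h2
  rw [e]
  have := Real.exp_pos (-(s * L))
  nlinarith

lemma norm_one_sub_exp_le {φ : ℝ} (h : |φ| ≤ Real.pi / 2) :
    ‖1 + -Complex.exp (φ * Complex.I)‖ ≤ √2 := by
  have hc : 0 ≤ Real.cos φ :=
    Real.cos_nonneg_of_mem_Icc ⟨by linarith [(abs_le.mp h).1], (abs_le.mp h).2⟩
  apply Real.le_sqrt_of_sq_le
  rw [← Complex.normSq_eq_norm_sq, Complex.normSq_apply]
  simp only [Complex.add_re, Complex.add_im, Complex.neg_re, Complex.neg_im, Complex.one_re,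
    Complex.one_im, Complex.exp_ofReal_mul_I_re, Complex.exp_ofReal_mul_I_im]
  nlinarith [Real.sin_sq_add_cos_sq φ]

/-- Fourier inversion on `ℤ / 4`: the function is the sum of the `w`-th powers of the fourth roots
of unity. The three roots other than `1` all satisfy `‖1 + ζ‖ ≤ √2`. -/
lemma highFrequency_four_dvd :
    HighFrequency (fun w => if 4 ∣ w then 4 else 0) 3 := by
  refine ⟨Fin 3, inferInstance, fun _ => 1, ![-1, Complex.I, -Complex.I], ?_, ?_, ?_, by simp⟩
  · intro w
    have h4 : w = 4 * (w / 4) + w % 4 := (Nat.div_add_mod w 4).symm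
    have hlt : w % 4 < 4 := Nat.mod_lt _ (by norm_num)
    generalize w / 4 = a at h4
    generalize w % 4 = r at h4 hlt
    subst h4
    have hI : (-Complex.I) ^ 4 = 1 := by rw [neg_pow, Complex.I_pow_four]; norm_num
    have hd : (4 ∣ 4 * a + r) ↔ r = 0 := by omega
    simp only [hd, Fin.sum_univ_three, Matrix.cons_val_zero, Matrix.cons_val_one, Matrix.cons_val,
      pow_add, pow_mul, Complex.I_pow_four, hI, one_pow, one_mul]
    interval_cases r
    · norm_num
    · norm_num
    · norm_num [Complex.I_sq]
    · have : Complex.I ^ 3 = -Complex.I := Complex.I_pow_three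
      have h2 : (-Complex.I) ^ 3 = Complex.I := by rw [neg_pow, this]; norm_num
      rw [this, h2]; norm_num
  · intro j; fin_cases j <;> simp
  · have h1 : ‖1 + Complex.I‖ ≤ √2 := by
      apply Real.le_sqrt_of_sq_le
      rw [← Complex.normSq_eq_norm_sq, Complex.normSq_apply]; norm_num
    have h2 : ‖1 + -Complex.I‖ ≤ √2 := by
      apply Real.le_sqrt_of_sq_le
      rw [← Complex.normSq_eq_norm_sq, Complex.normSq_apply]; norm_num
    intro j; fin_cases j
    · simp
    · simpa using h1
    · simpa using h2

/-! ### Trigonometric construction of the profile of the positive label. -/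

/-- The additive character `k ↦ exp (2 π i k / (4 R))`. -/
noncomputable def chi (R : ℕ) (k : ℤ) : ℂ :=
  Complex.exp ((2 * Real.pi * k / (4 * R) : ℝ) * Complex.I)

lemma chi_zero (R : ℕ) : chi R 0 = 1 := by simp [chi]

lemma chi_add (R : ℕ) (k l : ℤ) : chi R (k + l) = chi R k * chi R l := by
  rw [chi, chi, chi, ← Complex.exp_add]; congr 1; push_cast; ring

lemma norm_chi (R : ℕ) (k : ℤ) : ‖chi R k‖ = 1 := Complex.norm_exp_ofReal_mul_I _

lemma chi_mul_nat (R : ℕ) (k : ℤ) (w : ℕ) : chi R (k * w) = chi R k ^ w := by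
  rw [chi, chi, ← Complex.exp_nat_mul]; congr 1; push_cast; ring

lemma conj_chi (R : ℕ) (k : ℤ) : (starRingEnd ℂ) (chi R k) = chi R (-k) := by
  rw [chi, chi, ← Complex.exp_conj]
  congr 1
  rw [map_mul, Complex.conj_I, Complex.conj_ofReal]
  push_cast; ring

lemma sum_chi_eq_zero {R : ℕ} {d : ℤ} (hd : d ≠ 0) (hdR : |d| < R) :
    ∑ j : Fin R, chi R (4 * d * (j : ℕ)) = 0 := by
  have hR : 0 < R := by have := abs_nonneg d; omega
  have hR' : (R : ℝ) ≠ 0 := by exact_mod_cast hR.ne'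
  simp only [chi_mul_nat]
  rw [Fin.sum_univ_eq_sum_range (fun j => chi R (4 * d) ^ j)]
  have e : chi R (4 * d) = Complex.exp (2 * Real.pi * Complex.I * (d / R)) := by
    rw [chi]; congr 1; push_cast
    have : (R : ℂ) ≠ 0 := by exact_mod_cast hR.ne'
    field_simp
  have h1 : chi R (4 * d) ≠ 1 := by
    rw [e, Ne, Complex.exp_eq_one_iff]
    rintro ⟨m, hm⟩
    have hpi : (2 * Real.pi * Complex.I : ℂ) ≠ 0 := Complex.two_pi_I_ne_zero
    rw [mul_comm, mul_left_inj' hpi] at hm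
    have hRc : (R : ℂ) ≠ 0 := by exact_mod_cast hR.ne'
    rw [div_eq_iff hRc] at hm
    have hm' : d = m * R := by exact_mod_cast hm
    have hm0 : m ≠ 0 := by rintro rfl; simp at hm'; exact hd hm'
    rw [hm', abs_mul, Nat.abs_cast] at hdR
    have : 1 ≤ |m| := Int.one_le_abs hm0
    nlinarith
  have h2 : chi R (4 * d) ^ R = 1 := by
    rw [← chi_mul_nat, chi]
    rw [Complex.exp_eq_one_iff]
    refine ⟨d, ?_⟩
    have hRc : (R : ℂ) ≠ 0 := by exact_mod_cast hR.ne'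
    push_cast
    field_simp
  have := mul_neg_geom_sum (chi R (4 * d)) R
  rw [h2, sub_self] at this
  rcases mul_eq_zero.mp this with h | h
  · exact absurd (sub_eq_zero.mp h).symm h1
  · exact h

/-- The unit vector of samples of the frequency `w`. -/
noncomputable def wave (R w : ℕ) : EuclideanSpace ℂ (Fin R) :=
  WithLp.toLp 2 fun j => chi R ((w : ℤ) * (j : ℕ)) / (√R : ℝ)

lemma inner_wave {R : ℕ} (z w : ℕ) :
    inner ℂ (wave R z) (wave R w) = (∑ j : Fin R, chi R (((w : ℤ) - z) * (j : ℕ))) / R := by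
  rw [PiLp.inner_apply, Finset.sum_div]
  refine Finset.sum_congr rfl fun j _ => ?_
  simp only [wave, RCLike.inner_apply, map_div₀, conj_chi, Complex.conj_ofReal]
  rw [div_mul_div_comm, ← chi_add, ← Complex.ofReal_mul, Real.mul_self_sqrt (Nat.cast_nonneg _)]
  congr 2
  ring

lemma norm_wave {R : ℕ} (hR : 0 < R) (w : ℕ) : ‖wave R w‖ = 1 := by
  have h := inner_wave (R := R) w w
  have hRc : (R : ℂ) ≠ 0 := by exact_mod_cast hR.ne'
  rw [inner_self_eq_norm_sq_to_K] at h
  simp only [sub_self, zero_mul, chi_zero, Finset.sum_const, Finset.card_univ, Fintype.card_fin,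
    nsmul_eq_mul, mul_one, div_self hRc] at h
  have h2 : ‖wave R w‖ ^ 2 = 1 := by
    apply Complex.ofReal_injective
    rw [Complex.ofReal_pow, Complex.ofReal_one]
    exact h
  nlinarith [norm_nonneg (wave R w)]

/-- The factor `4` in the period `4 * R` of `chi` turns multiples of `4` into frequencies of `R`-th
roots of unity, and distinct characters of `ℤ / R` are orthogonal. -/
lemma inner_wave_eq_zero {R z w : ℕ} (hz : 4 ∣ z) (hw : 4 ∣ w) (hzw : z ≠ w) (hzR : z < R)
    (hwR : w < R) : inner ℂ (wave R z) (wave R w) = 0 := by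
  obtain ⟨z, rfl⟩ := hz
  obtain ⟨w, rfl⟩ := hw
  rw [inner_wave]
  have h := sum_chi_eq_zero (R := R) (d := (w : ℤ) - z) (by omega)
    (by rw [abs_lt]; constructor <;> omega)
  have e : (((4 * w : ℕ) : ℤ) - ((4 * z : ℕ) : ℤ)) = 4 * ((w : ℤ) - z) := by push_cast; ring
  rw [e, h, zero_div]

/-- As a function of `w`, the squared inner product only has frequencies that are differences of two
sample indices, hence smaller than `R` out of `4 * R`. -/
lemma norm_inner_wave_sq {R : ℕ} (z w : ℕ) :
    ((‖inner ℂ (wave R z) (wave R w)‖ ^ 2 : ℝ) : ℂ) =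
      ∑ p : Fin R × Fin R, (1 / (R : ℂ) ^ 2) * chi R (-(((p.1 : ℕ) : ℤ) - (p.2 : ℕ)) * z) *
        chi R (((p.1 : ℕ) : ℤ) - (p.2 : ℕ)) ^ w := by
  rw [Complex.ofReal_pow, ← Complex.mul_conj', inner_wave, map_div₀, map_sum]
  simp only [conj_chi, Complex.conj_natCast]
  rw [div_mul_div_comm, Finset.sum_mul_sum, Fintype.sum_prod_type, Finset.sum_div]
  refine Finset.sum_congr rfl fun i _ => ?_
  rw [Finset.sum_div]
  refine Finset.sum_congr rfl fun j _ => ?_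
  rw [← chi_mul_nat, ← chi_add, mul_assoc, ← chi_add, ← sq, div_mul_eq_mul_div, one_mul]
  congr 2
  ring

/-- The squared length of the projection of a wave to the span of the waves with index in `Z`. -/
noncomputable def bump (R : ℕ) (Z : Finset ℕ) (w : ℕ) : ℝ :=
  ∑ z ∈ Z, ‖inner ℂ (wave R z) (wave R w)‖ ^ 2

lemma bump_nonneg (R : ℕ) (Z : Finset ℕ) (w : ℕ) : 0 ≤ bump R Z w :=
  Finset.sum_nonneg fun z _ => by positivity

/-- Bessel's inequality for the orthonormal waves with index in `Z`. -/
lemma bump_le_one {R : ℕ} {Z : Finset ℕ} (hZ : ∀ z ∈ Z, 4 ∣ z ∧ z < R) (hR : 0 < R) (w : ℕ) :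
    bump R Z w ≤ 1 := by
  have orth : Orthonormal ℂ fun z : Z => wave R z := by
    refine ⟨fun z => norm_wave hR z, fun z z' hzz => ?_⟩
    obtain ⟨h1, h2⟩ := hZ z z.2
    obtain ⟨h3, h4⟩ := hZ z' z'.2
    exact inner_wave_eq_zero h1 h3 (fun h => hzz (Subtype.ext h)) h2 h4
  have := orth.sum_inner_products_le (wave R w) (s := Finset.univ)
  rw [norm_wave hR, one_pow] at this
  rwa [bump, ← Finset.sum_coe_sort]

lemma bump_eq_one {R : ℕ} {Z : Finset ℕ} (hZ : ∀ z ∈ Z, 4 ∣ z ∧ z < R) (hR : 0 < R) {z : ℕ}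
    (hz : z ∈ Z) : bump R Z z = 1 := by
  refine le_antisymm (bump_le_one hZ hR z) ?_
  have h : ‖inner ℂ (wave R z) (wave R z)‖ ^ 2 = 1 := by
    rw [inner_self_eq_norm_sq_to_K, norm_wave hR]
    simp
  rw [← h]
  exact Finset.single_le_sum (f := fun y => ‖inner ℂ (wave R y) (wave R z)‖ ^ 2)
    (fun y _ => by positivity) hz

lemma bump_eq_zero {R : ℕ} {Z : Finset ℕ} (hZ : ∀ z ∈ Z, 4 ∣ z ∧ z < R) {w : ℕ} (hw : w < R)
    (hw4 : 4 ∣ w) (hwZ : w ∉ Z) : bump R Z w = 0 := by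
  apply Finset.sum_eq_zero
  intro z hz
  rw [inner_wave_eq_zero (hZ z hz).1 hw4 (fun h => hwZ (h ▸ hz)) (hZ z hz).2 hw]
  simp

lemma ofReal_bump (R : ℕ) (Z : Finset ℕ) (w : ℕ) :
    (bump R Z w : ℂ) = ∑ z : Z, ∑ p : Fin R × Fin R,
      (1 / (R : ℂ) ^ 2) * chi R (-(((p.1 : ℕ) : ℤ) - (p.2 : ℕ)) * (z : ℕ)) *
        chi R (((p.1 : ℕ) : ℤ) - (p.2 : ℕ)) ^ w := by
  rw [bump, Complex.ofReal_sum, ← Finset.sum_coe_sort]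
  exact Finset.sum_congr rfl fun z _ => norm_inner_wave_sq _ _

/-- The angles in `bump` are at most `π / 2`, so the factor `(-1) ^ w` moves every frequency to the
half circle around `-1`, as `HighFrequency` demands. The `R ^ 2` terms for each `z` have
coefficients of norm `1 / R ^ 2`, which gives total size `#Z`. -/
lemma highFrequency_bump {R : ℕ} (hR : 0 < R) (Z : Finset ℕ) :
    HighFrequency (fun w => 1 - (-1) ^ w * bump R Z w) #Z := by
  have hRr : (0 : ℝ) < R := by exact_mod_cast hR
  refine ⟨Z × Fin R × Fin R, inferInstance,
    fun p => -((1 / (R : ℂ) ^ 2) * chi R (-(((p.2.1 : ℕ) : ℤ) - (p.2.2 : ℕ)) * (p.1 : ℕ))),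
    fun p => -chi R (((p.2.1 : ℕ) : ℤ) - (p.2.2 : ℕ)), ?_, ?_, ?_, ?_⟩
  · intro w
    rw [Complex.ofReal_sub, Complex.ofReal_mul, ofReal_bump, Fintype.sum_prod_type, sub_eq_add_neg,
      Finset.mul_sum, ← Finset.sum_neg_distrib]
    simp only [Complex.ofReal_one, Complex.ofReal_pow, Complex.ofReal_neg]
    congr 1
    refine Finset.sum_congr rfl fun z _ => ?_
    rw [Finset.mul_sum, ← Finset.sum_neg_distrib]
    refine Finset.sum_congr rfl fun p _ => ?_
    rw [neg_pow (chi R _) w]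
    ring
  · intro p
    rw [norm_neg, norm_chi]
  · intro p
    apply norm_one_sub_exp_le
    have hj : |((((p.2.1 : ℕ) : ℤ) - ((p.2.2 : ℕ) : ℤ) : ℤ) : ℝ)| ≤ R := by
      have h1 := p.2.1.2
      have h2 := p.2.2.2
      rw [← Int.cast_abs]
      have : |((p.2.1 : ℕ) : ℤ) - ((p.2.2 : ℕ) : ℤ)| ≤ R := by
        rw [abs_le]; constructor <;> omega
      exact_mod_cast this
    rw [abs_div, abs_mul, abs_of_pos (by positivity : 0 < 2 * Real.pi),
      abs_of_pos (by positivity : 0 < 4 * (R : ℝ)), div_le_iff₀ (by positivity)]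
    nlinarith [Real.pi_pos]
  · simp only [norm_neg, norm_mul, norm_chi, mul_one, Finset.sum_const, Finset.card_univ,
      Fintype.card_prod, Fintype.card_coe, Fintype.card_fin, nsmul_eq_mul, norm_div, norm_one,
      norm_pow, Complex.norm_natCast, Nat.cast_mul]
    have : (R : ℝ) ≠ 0 := hRr.ne'
    apply le_of_eq
    field_simp

/-- A nonnegative high frequency profile that vanishes on a given set of multiples of `4` and
equals `1` on all other multiples of `4` in a given range. -/
lemma exists_profile (N : ℕ) (Z : Finset ℕ) (hZ : ∀ z ∈ Z, 4 ∣ z ∧ z ≤ N) :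
    ∃ a : ℕ → ℝ, HighFrequency a #Z ∧ (∀ w, 0 ≤ a w) ∧ (∀ w, a w ≤ 2) ∧ (∀ z ∈ Z, a z = 0) ∧
      ∀ w ≤ N, 4 ∣ w → w ∉ Z → a w = 1 := by
  have hZ' : ∀ z ∈ Z, 4 ∣ z ∧ z < N + 1 :=
    fun z hz => ⟨(hZ z hz).1, Nat.lt_succ_of_le (hZ z hz).2⟩
  have hR : 0 < N + 1 := N.succ_pos
  have sgn : ∀ w : ℕ, (-1 : ℝ) ^ w = 1 ∨ (-1 : ℝ) ^ w = -1 := neg_one_pow_eq_or ℝ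
  -- At multiples of `4` the modulating sign is harmless, and the profile is `1 - bump` there.
  have h4 : ∀ w : ℕ, 4 ∣ w → (-1 : ℝ) ^ w = 1 := by
    intro w hw
    exact Even.neg_one_pow (by rw [even_iff_two_dvd]; omega)
  refine ⟨_, highFrequency_bump hR Z, fun w => ?_, fun w => ?_, fun z hz => ?_,
    fun w hw hw4 hwZ => ?_⟩
  · have h0 := bump_nonneg (N + 1) Z w
    have h1 := bump_le_one hZ' hR w
    rcases sgn w with h | h <;> simp only [h] <;> linarith
  · have h0 := bump_nonneg (N + 1) Z w
    have h1 := bump_le_one hZ' hR w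
    rcases sgn w with h | h <;> simp only [h] <;> linarith
  · simp only [h4 z (hZ z hz).1, bump_eq_one hZ' hR hz]
    norm_num
  · simp only [bump_eq_zero hZ' (Nat.lt_succ_of_le hw) hw4 hwZ]
    norm_num

/-! ### Well separated words. -/

/-- Reed-Solomon codes: many words, any two of which differ in almost all places. -/
lemma exists_code {q n : ℕ} [Fact q.Prime] (hn : n ≤ q) (k : ℕ) :
    ∃ V : (Fin k → ZMod q) → Fin n → ZMod q,
      ∀ c c', c ≠ c' → n ≤ hammingDist (V c) (V c') + k := by
  let P : (Fin k → ZMod q) → Polynomial (ZMod q) := fun c =>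
    ((Polynomial.degreeLTEquiv (ZMod q) k).symm c : Polynomial (ZMod q))
  refine ⟨fun c i => (P c).eval ((i : ℕ) : ZMod q), fun c c' hcc => ?_⟩
  have hne : P c - P c' ≠ 0 := by
    rw [sub_ne_zero]
    intro h
    exact hcc ((Polynomial.degreeLTEquiv (ZMod q) k).symm.injective (Subtype.ext h))
  have hdeg : (P c - P c').natDegree ≤ k := by
    have h1 : P c - P c' ∈ Polynomial.degreeLT (ZMod q) k :=
      Submodule.sub_mem _ (Subtype.mem _) (Subtype.mem _)
    rw [Polynomial.mem_degreeLT] at h1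
    exact Polynomial.natDegree_le_of_degree_le h1.le
  -- Places of agreement are roots of `P c - P c'`; the evaluation points are distinct modulo `q`
  -- because `n ≤ q`.
  have hagree : #{i : Fin n | (P c).eval ((i : ℕ) : ZMod q) = (P c').eval ((i : ℕ) : ZMod q)} ≤ k := by
    refine le_trans ?_ ((Polynomial.card_roots' (P c - P c')).trans hdeg)
    refine le_trans ?_ (Multiset.toFinset_card_le _)
    refine Finset.card_le_card_of_injOn (fun i : Fin n => ((i : ℕ) : ZMod q)) ?_ ?_
    · intro i hi
      simp only [Finset.coe_filter, Finset.mem_univ, true_and, Set.mem_ofPred_eq] at hi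
      simp [Polynomial.mem_roots hne, hi]
    · intro i _ j _ hij
      have h := (ZMod.natCast_eq_natCast_iff' _ _ _).mp hij
      rw [Nat.mod_eq_of_lt (i.2.trans_le hn), Nat.mod_eq_of_lt (j.2.trans_le hn)] at h
      exact Fin.ext h
  have hsum := Finset.card_filter_add_card_filter_not (s := (Finset.univ : Finset (Fin n)))
    (fun i : Fin n => (P c).eval ((i : ℕ) : ZMod q) = (P c').eval ((i : ℕ) : ZMod q))
  rw [Finset.card_univ, Fintype.card_fin] at hsum
  simp only [hammingDist, ne_eq]
  omega

/-! ### Second moment bounds for queries. -/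

section SecondMoment

variable {X I : Type*} [Fintype X] [Nonempty X] [DecidableEq I] {α : I → X → ℝ} {B γ : ℝ}

/-- A bounded function can be correlated with few members of a nearly orthogonal family. -/
lemma sq_sum_abs_expect_le (hB : ∀ v x, |α v x| ≤ B)
    (hγ : ∀ u v, u ≠ v → |𝔼 x, α u x * α v x| ≤ γ) (hγ0 : 0 ≤ γ)
    {φ : X → ℝ} (hφ : ∀ x, |φ x| ≤ 1) (T : Finset I) :
    (∑ v ∈ T, |𝔼 x, φ x * α v x|) ^ 2 ≤ #T * B ^ 2 + (#T : ℝ) ^ 2 * γ := by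
  -- Signs turn the sum of absolute values into one expectation against `φ`, to which Cauchy-Schwarz
  -- applies; the square expands into pairwise correlations.
  set s : I → ℝ := fun v => SignType.sign (𝔼 x, φ x * α v x) with hs
  have hs1 : ∀ v, |s v| ≤ 1 := by
    intro v
    simp only [hs]
    cases SignType.sign (𝔼 x, φ x * α v x) <;> simp
  have e1 : ∑ v ∈ T, |𝔼 x, φ x * α v x| = 𝔼 x, φ x * ∑ v ∈ T, s v * α v x := by
    simp only [Finset.mul_sum, Finset.expect_sum_comm]
    refine Finset.sum_congr rfl fun v _ => ?_
    rw [← sign_mul_self, Finset.mul_expect]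
    exact Finset.expect_congr rfl fun x _ => by simp only [hs]; ring
  have hφ2 : 𝔼 x, φ x ^ 2 ≤ 1 := by
    refine (Finset.expect_le_expect (g := fun _ => (1 : ℝ)) fun x _ => ?_).trans
      (by rw [Fintype.expect_const])
    exact (sq_le_one_iff_abs_le_one _).mpr (hφ x)
  have e2 : 𝔼 x, (∑ v ∈ T, s v * α v x) ^ 2 =
      ∑ u ∈ T, ∑ v ∈ T, s u * s v * 𝔼 x, α u x * α v x := by
    simp only [Finset.mul_expect, ← Finset.expect_sum_comm, sq, Finset.sum_mul_sum]
    exact Finset.expect_congr rfl fun x _ => Finset.sum_congr rfl fun u _ =>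
      Finset.sum_congr rfl fun v _ => by ring
  have hterm : ∀ u v, s u * s v * 𝔼 x, α u x * α v x ≤ (if u = v then B ^ 2 else 0) + γ := by
    intro u v
    have h1 : s u * s v * 𝔼 x, α u x * α v x ≤ |𝔼 x, α u x * α v x| := by
      refine (le_abs_self _).trans ?_
      rw [abs_mul, abs_mul]
      have := mul_le_one₀ (hs1 u) (abs_nonneg _) (hs1 v)
      exact mul_le_of_le_one_left (abs_nonneg _) this
    refine h1.trans ?_
    split_ifs with huv
    · subst huv
      have h2 : ∀ x, α u x * α u x ≤ B ^ 2 := by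
        intro x
        rw [← sq]
        exact sq_le_sq' (abs_le.mp (hB u x)).1 (abs_le.mp (hB u x)).2
      have h3 : 0 ≤ 𝔼 x, α u x * α u x := Finset.expect_nonneg fun x _ => mul_self_nonneg _
      rw [abs_of_nonneg h3]
      have h4 : 𝔼 x, α u x * α u x ≤ B ^ 2 := by
        refine (Finset.expect_le_expect (g := fun _ => B ^ 2) fun x _ => h2 x).trans
          (by rw [Fintype.expect_const])
      linarith
    · linarith [hγ u v huv]
  rw [e1]
  calc (𝔼 x, φ x * ∑ v ∈ T, s v * α v x) ^ 2
      ≤ (𝔼 x, φ x ^ 2) * 𝔼 x, (∑ v ∈ T, s v * α v x) ^ 2 :=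
        Finset.expect_mul_sq_le_sq_mul_sq _ _ _
    _ ≤ 1 * 𝔼 x, (∑ v ∈ T, s v * α v x) ^ 2 := by
        refine mul_le_mul_of_nonneg_right hφ2 (Finset.expect_nonneg fun x _ => sq_nonneg _)
    _ ≤ ∑ u ∈ T, ∑ v ∈ T, ((if u = v then B ^ 2 else 0) + γ) := by
        rw [one_mul, e2]
        exact Finset.sum_le_sum fun u _ => Finset.sum_le_sum fun v _ => hterm u v
    _ = _ := by
        have : ∀ u ∈ T, ∑ v ∈ T, ((if u = v then B ^ 2 else 0) + γ) = B ^ 2 + #T * γ := by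
          intro u hu
          rw [Finset.sum_add_distrib, Finset.sum_ite_eq]
          simp [hu]
        rw [Finset.sum_congr rfl this]
        simp only [Finset.sum_const, nsmul_eq_mul]
        ring

/-- The two labels carry the families `α` and `β` with masses `1 - p` and `p`, and convexity of the
square combines their second moment bounds. The hypothesis `γ ≤ τ ^ 2 / 2` lets the off-diagonal
term be absorbed by the left side. -/
lemma card_correlated_le {β : I → X → ℝ} (hBα : ∀ v x, |α v x| ≤ B) (hBβ : ∀ v x, |β v x| ≤ B)
    (hα : ∀ u v, u ≠ v → |𝔼 x, α u x * α v x| ≤ γ)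
    (hβ : ∀ u v, u ≠ v → |𝔼 x, β u x * β v x| ≤ γ) (hγ0 : 0 ≤ γ) {p τ : ℝ} (hp0 : 0 ≤ p)
    (hp1 : p ≤ 1) (hτ : 0 < τ) (hγτ : γ ≤ τ ^ 2 / 2) {φ ψ : X → ℝ} (hφ : ∀ x, |φ x| ≤ 1)
    (hψ : ∀ x, |ψ x| ≤ 1) (T : Finset I)
    (hT : ∀ v ∈ T, τ < |(1 - p) * 𝔼 x, φ x * α v x + p * 𝔼 x, ψ x * β v x|) :
    (#T : ℝ) ≤ 2 * B ^ 2 / τ ^ 2 := by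
  have h1 := sq_sum_abs_expect_le hBα hα hγ0 hφ T
  have h2 := sq_sum_abs_expect_le hBβ hβ hγ0 hψ T
  set a := ∑ v ∈ T, |𝔼 x, φ x * α v x| with ha
  set b := ∑ v ∈ T, |𝔼 x, ψ x * β v x| with hb
  have h3 : #T * τ ≤ (1 - p) * a + p * b := by
    rw [ha, hb, Finset.mul_sum, Finset.mul_sum, ← Finset.sum_add_distrib, ← nsmul_eq_mul,
      ← Finset.sum_const]
    refine Finset.sum_le_sum fun v hv => (hT v hv).le.trans ?_
    refine (abs_add_le _ _).trans ?_
    rw [abs_mul, abs_mul, abs_of_nonneg hp0, abs_of_nonneg (sub_nonneg.mpr hp1)]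
  have h4 : (#T * τ) ^ 2 ≤ #T * B ^ 2 + (#T : ℝ) ^ 2 * γ := by
    have h5 : (#T * τ) ^ 2 ≤ ((1 - p) * a + p * b) ^ 2 := by gcongr
    have h6 : ((1 - p) * a + p * b) ^ 2 ≤ (1 - p) * a ^ 2 + p * b ^ 2 := by
      nlinarith [mul_nonneg (mul_nonneg hp0 (sub_nonneg.mpr hp1)) (sq_nonneg (a - b))]
    nlinarith
  rcases Nat.eq_zero_or_pos #T with h0 | h0
  · rw [h0]; simp; positivity
  have hT0 : (0 : ℝ) < #T := by exact_mod_cast h0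
  rw [le_div_iff₀ (by positivity)]
  have h7 : (#T : ℝ) * τ ^ 2 ≤ B ^ 2 + #T * γ := by
    refine le_of_mul_le_mul_left ?_ hT0
    nlinarith
  nlinarith

end SecondMoment

/-! ### From few correlated indices to the failure of every learner. -/

/-- An algorithm gets the reference answers throughout, hence returns the reference output, outside
of a small set of indices. -/
lemma exists_exceptional {M : ℕ} {I : Type*} [DecidableEq I] (bad : SQuery M → Finset I) {β : ℕ}
    (hbad : ∀ f, #(bad f) ≤ β) (O₀ : SQuery M → ℝ) (A : SQAlgorithm M) :
    ∀ q, A.QueriesAtMost q → ∃ E : Finset I, #E ≤ q * β ∧ ∀ v ∉ E, ∀ O : SQuery M → ℝ,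
      (∀ f, v ∉ bad f → O f = O₀ f) → A.run O = A.run O₀ := by
  induction A with
  | output h => exact fun q _ => ⟨∅, by simp, fun _ _ _ _ => rfl⟩
  | query f next ih =>
    intro q hq
    match q, hq with
    | q + 1, hq =>
      -- Only the branch of the reference answers matters, so exceptional indices accumulate along a
      -- single path.
      obtain ⟨E, hE, hrun⟩ := ih (O₀ f) q (hq (O₀ f))
      refine ⟨bad f ∪ E, ?_, fun v hv O hO => ?_⟩
      · have := Finset.card_union_le (bad f) E
        have := hbad f
        linarith [add_mul q 1 β]
      · rw [Finset.mem_union, not_or] at hv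
        rw [SQAlgorithm.run, SQAlgorithm.run, hO f hv.1]
        exact hrun v hv.2 O hO

/-- If each index succeeds with probability at least `2 / 3`, while for each seed few indices
succeed, then there are few indices. -/
lemma card_le_of_success {Ω I : Type*} [MeasurableSpace Ω] [Fintype I] [DecidableEq I]
    (μ : Measure Ω) [IsProbabilityMeasure μ] (S : I → Set Ω) (hS : ∀ v, MeasurableSet (S v))
    (hμ : ∀ v, 2 / 3 ≤ μ (S v)) (N : ℕ)
    (hN : ∀ ω, ∃ E : Finset I, #E ≤ N ∧ ∀ v, ω ∈ S v → v ∈ E) :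
    2 * Fintype.card I ≤ 3 * N := by
  have h1 : ∑ v, μ (S v) ≤ N := by
    calc ∑ v, μ (S v) = ∑ v, ∫⁻ ω, (S v).indicator 1 ω ∂μ := by
          simp only [lintegral_indicator_one (hS _)]
      _ = ∫⁻ ω, ∑ v, (S v).indicator 1 ω ∂μ := by
          rw [lintegral_finsetSum]
          exact fun v _ => measurable_one.indicator (hS v)
      _ ≤ ∫⁻ _, (N : ENNReal) ∂μ := by
          refine lintegral_mono fun ω => ?_
          obtain ⟨E, hE, hsub⟩ := hN ω
          calc ∑ v, (S v).indicator (1 : Ω → ENNReal) ω ≤ ∑ v, if v ∈ E then 1 else 0 := by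
                refine Finset.sum_le_sum fun v _ => ?_
                by_cases h : ω ∈ S v
                · simp [h, hsub v h]
                · simp [h]
            _ = #E := by simp
            _ ≤ N := by exact_mod_cast hE
      _ = N := by simp
  have h2 : (Fintype.card I : ENNReal) * (2 / 3) ≤ N := by
    refine le_trans ?_ h1
    calc (Fintype.card I : ENNReal) * (2 / 3) = ∑ _v : I, (2 / 3 : ENNReal) := by simp
      _ ≤ _ := Finset.sum_le_sum fun v _ => hμ v
  have h3 := ENNReal.toReal_mono (ENNReal.natCast_ne_top N) h2
  rw [ENNReal.toReal_mul, ENNReal.toReal_div] at h3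
  simp at h3
  have h4 : (2 * Fintype.card I : ℝ) ≤ 3 * N := by linarith
  exact_mod_cast h4

lemma measurableSet_error {M : ℕ} {h : (Fin M → ℝ) → ℤˣ} (hh : Measurable h) :
    MeasurableSet {z : Example M | h z.1 ≠ z.2} :=
  (measurableSet_eq_fun (hh.comp measurable_fst) measurable_snd).compl

/-- The query for the error of a hypothesis. -/
noncomputable def errorQuery {M : ℕ} {h : (Fin M → ℝ) → ℤˣ} (hh : Measurable h) : SQuery M where
  toFun := {z : Example M | h z.1 ≠ z.2}.indicator 1
  measurable := measurable_one.indicator (measurableSet_error hh)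
  mem_Icc z := by
    by_cases hz : z ∈ {z : Example M | h z.1 ≠ z.2}
    · rw [Set.indicator_of_mem hz]; norm_num
    · rw [Set.indicator_of_notMem hz]; norm_num

lemma errorQuery_apply {M : ℕ} {h : (Fin M → ℝ) → ℤˣ} (hh : Measurable h) (z : Example M) :
    (errorQuery hh).toFun z = if h z.1 ≠ z.2 then 1 else 0 := by
  simp [errorQuery, Set.indicator_apply]

lemma misclassification_eq {M : ℕ} (D : Measure (Example M)) [IsProbabilityMeasure D]
    {h : (Fin M → ℝ) → ℤˣ} (hh : Measurable h) :
    misclassification D h = ENNReal.ofReal (∫ z, (errorQuery hh).toFun z ∂D) := by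
  rw [errorQuery, integral_indicator_one (measurableSet_error hh), misclassification,
    ofReal_measureReal]

/-- The adversary gives the answers of `E₀` whenever these are valid. For a fixed seed, an index
outside the exceptional set yields the reference output, whose error is too large. Averaging over
the seed bounds the number of indices. -/
lemma not_learns_of_family {M : ℕ} {I : Type*} [Fintype I] [DecidableEq I]
    (D : I → Measure (Example M)) (hD : ∀ v, IsProbabilityMeasure (D v)) (E₀ : SQuery M → ℝ)
    {η opt τ err : ℝ} (hMassart : ∀ v, IsMassartHalfspace η (D v))
    (hopt : ∀ v, optError (D v) ≤ ENNReal.ofReal opt) (hτ : 0 ≤ τ) {β : ℕ}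
    (hbad : ∀ f : SQuery M, #{v | τ < |∫ z, f.toFun z ∂(D v) - E₀ f|} ≤ β)
    (herr : ∀ (h : (Fin M → ℝ) → ℤˣ) (hh : Measurable h), err + τ ≤ E₀ (errorQuery hh))
    {Ω : Type*} [MeasurableSpace Ω] (μ : Measure Ω) [IsProbabilityMeasure μ]
    (A : Ω → SQAlgorithm M) {q : ℕ} (hA : ∀ ω, (A ω).QueriesAtMost q)
    (hcard : 3 * ((q + 1) * β) < 2 * Fintype.card I) :
    ¬ LearnsMassartHalfspaces μ A η opt τ err := by
  intro hL
  let bad : SQuery M → Finset I := fun f => {v | τ < |∫ z, f.toFun z ∂(D v) - E₀ f|}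
  let O : I → SQuery M → ℝ := fun v f => if v ∈ bad f then ∫ z, f.toFun z ∂(D v) else E₀ f
  have hO : ∀ v, IsSTATOracle (D v) τ (O v) := by
    intro v f
    by_cases hv : v ∈ bad f
    · simp only [O, hv, if_true]
      exact ⟨by linarith, by linarith⟩
    · simp only [O, hv, if_false]
      simp only [bad, Finset.mem_filter, Finset.mem_univ, true_and, not_lt] at hv
      obtain ⟨h1, h2⟩ := abs_le.mp hv
      exact ⟨by linarith, by linarith⟩
  choose S hS hμ hrun using fun v => hL (D v) (hMassart v) (hopt v) (O v) (hO v)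
  refine absurd (card_le_of_success μ S hS hμ ((q + 1) * β) fun ω => ?_) (not_le.mpr hcard)
  obtain ⟨E, hE, hEv⟩ := exists_exceptional bad hbad E₀ (A ω) q (hA ω)
  have hm := ((A ω).run E₀).measurable
  -- The error of the reference output is treated as one more query, hence `q + 1`.
  refine ⟨E ∪ bad (errorQuery hm), ?_, fun v hv => ?_⟩
  · have := Finset.card_union_le E (bad (errorQuery hm))
    have : #(bad (errorQuery hm)) ≤ β := hbad _
    linarith [add_mul q 1 β]
  · by_contra hvE
    rw [Finset.mem_union, not_or] at hvE
    have h1 := hrun v ω hv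
    rw [hEv v hvE.1 (O v) fun f hf => by simp only [O, hf, if_false]] at h1
    have := hD v
    rw [misclassification_eq (D v) hm] at h1
    have h2 := hvE.2
    simp only [bad, Finset.mem_filter, Finset.mem_univ, true_and, not_lt] at h2
    have h3 := (abs_le.mp h2).1
    have h4 := herr _ hm
    exact absurd h1 (not_lt.mpr (ENNReal.ofReal_le_ofReal (by linarith)))

/-! ### Noisy laws and finitely supported marginals. -/

lemma isProbabilityMeasure_noisyLaw {M : ℕ} (Dx : Measure (Fin M → ℝ)) [IsProbabilityMeasure Dx]
    {f : (Fin M → ℝ) → ℤˣ} (hf : Measurable f) {ρ : (Fin M → ℝ) → ℝ} (hρ : Measurable ρ)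
    (h0 : ∀ x, 0 ≤ ρ x) (h1 : ∀ x, ρ x ≤ 1) : IsProbabilityMeasure (noisyLaw Dx f ρ) := by
  constructor
  rw [noisyLaw, Measure.add_apply, Measure.map_apply (by fun_prop) MeasurableSet.univ,
    Measure.map_apply (by fun_prop) MeasurableSet.univ, Set.preimage_univ, Set.preimage_univ,
    withDensity_apply _ MeasurableSet.univ, withDensity_apply _ MeasurableSet.univ,
    Measure.restrict_univ, ← lintegral_add_left (by fun_prop)]
  have : ∀ x, ENNReal.ofReal (1 - ρ x) + ENNReal.ofReal (ρ x) = 1 := by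
    intro x
    rw [← ENNReal.ofReal_add (by linarith [h1 x]) (h0 x)]
    simp
  simp [this]

lemma integral_noisyLaw {M : ℕ} (Dx : Measure (Fin M → ℝ)) [IsProbabilityMeasure Dx]
    {f : (Fin M → ℝ) → ℤˣ} (hf : Measurable f) {ρ : (Fin M → ℝ) → ℝ} (hρ : Measurable ρ)
    (h0 : ∀ x, 0 ≤ ρ x) (h1 : ∀ x, ρ x ≤ 1) (φ : SQuery M) :
    ∫ z, φ.toFun z ∂(noisyLaw Dx f ρ) =
      ∫ x, ((1 - ρ x) * φ.toFun (x, f x) + ρ x * φ.toFun (x, -f x)) ∂Dx := by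
  have hP := isProbabilityMeasure_noisyLaw Dx hf hρ h0 h1
  have hm := φ.measurable
  have hb : ∀ z, ‖φ.toFun z‖ ≤ 1 := fun z => abs_le.mpr (φ.mem_Icc z)
  have hint : Integrable φ.toFun (noisyLaw Dx f ρ) :=
    Integrable.of_bound hm.aestronglyMeasurable 1 (Filter.Eventually.of_forall hb)
  have hbd : ∀ (σ : (Fin M → ℝ) → ℝ) (g : (Fin M → ℝ) → ℤˣ), Measurable σ → Measurable g →
      (∀ x, 0 ≤ σ x) → (∀ x, σ x ≤ 1) → Integrable (fun x => σ x * φ.toFun (x, g x)) Dx := by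
    intro σ g hσ hg h0 h1
    refine Integrable.of_bound (C := 1) ?_ (Filter.Eventually.of_forall fun x => ?_)
    · exact (hσ.mul (hm.comp (measurable_id.prodMk hg))).aestronglyMeasurable
    · rw [norm_mul, Real.norm_of_nonneg (h0 x)]
      exact mul_le_one₀ (h1 x) (norm_nonneg _) (hb _)
  have hwd : ∀ (σ : (Fin M → ℝ) → ℝ) (g : (Fin M → ℝ) → ℤˣ), Measurable σ → Measurable g →
      (∀ x, 0 ≤ σ x) →
      ∫ z, φ.toFun z ∂((Dx.withDensity fun x => ENNReal.ofReal (σ x)).map fun x => (x, g x)) =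
        ∫ x, σ x * φ.toFun (x, g x) ∂Dx := by
    intro σ g hσ hg h0
    rw [integral_map (by fun_prop) hm.aestronglyMeasurable,
      integral_withDensity_eq_integral_toReal_smul (by fun_prop)
        (Filter.Eventually.of_forall fun x => ENNReal.ofReal_lt_top)]
    refine integral_congr_ae (Filter.Eventually.of_forall fun x => ?_)
    simp only [ENNReal.toReal_ofReal (h0 x), smul_eq_mul]
  have h0' : ∀ x, 0 ≤ 1 - ρ x := fun x => by linarith [h1 x]
  have h1' : ∀ x, 1 - ρ x ≤ 1 := fun x => by linarith [h0 x]
  rw [noisyLaw] at hint ⊢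
  rw [integral_add_measure hint.left_of_add_measure hint.right_of_add_measure,
    hwd (fun x => 1 - ρ x) f (by fun_prop) hf h0', hwd ρ (fun x => -f x) hρ (by fun_prop) h0,
    ← integral_add (hbd _ _ (by fun_prop) hf h0' h1') (hbd _ _ hρ (by fun_prop) h0 h1)]

/-- A law supported on finitely many points of `ℝ^M`. -/
noncomputable def finiteLaw {M : ℕ} {X : Type*} [Fintype X] (Φ : X → Fin M → ℝ) (m : X → ℝ) :
    Measure (Fin M → ℝ) :=
  ∑ x, ENNReal.ofReal (m x) • Measure.dirac (Φ x)

lemma isProbabilityMeasure_finiteLaw {M : ℕ} {X : Type*} [Fintype X] (Φ : X → Fin M → ℝ)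
    {m : X → ℝ} (h0 : ∀ x, 0 ≤ m x) (h1 : ∑ x, m x = 1) :
    IsProbabilityMeasure (finiteLaw Φ m) := by
  constructor
  rw [finiteLaw, Measure.finsetSum_apply]
  simp only [Measure.smul_apply, measure_univ, smul_eq_mul, mul_one]
  rw [← ENNReal.ofReal_sum_of_nonneg fun x _ => h0 x, h1, ENNReal.ofReal_one]

lemma integral_finiteLaw {M : ℕ} {X : Type*} [Fintype X] (Φ : X → Fin M → ℝ)
    {m : X → ℝ} (h0 : ∀ x, 0 ≤ m x) (g : (Fin M → ℝ) → ℝ) :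
    ∫ t, g t ∂(finiteLaw Φ m) = ∑ x, m x * g (Φ x) := by
  have hi : ∀ x : X, Integrable g (ENNReal.ofReal (m x) • Measure.dirac (Φ x)) := fun x =>
    Integrable.smul_measure (integrable_dirac enorm_lt_top) ENNReal.ofReal_ne_top
  rw [finiteLaw, integral_finsetSum_measure fun x _ => hi x]
  refine Finset.sum_congr rfl fun x _ => ?_
  rw [integral_smul_measure, integral_dirac, ENNReal.toReal_ofReal (h0 x), smul_eq_mul]

lemma measurable_signLabel : Measurable signLabel :=
  Measurable.ite measurableSet_Ici measurable_const measurable_const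

lemma measurable_of_isHalfspace {M : ℕ} {f : (Fin M → ℝ) → ℤˣ} (hf : IsHalfspace f) :
    Measurable f := by
  obtain ⟨w, θ, h⟩ := hf
  have : f = fun x => signLabel (dotProduct w x - θ) := funext h
  rw [this]
  refine measurable_signLabel.comp ?_
  unfold dotProduct
  fun_prop

/-! ### Polynomial features and the hard instances. -/

/-- A map of the cube to `ℝ^M`, by monomials, that makes all polynomials of degree at most `d` in
all linear forms linear. -/
lemma exists_features {ι : Type*} [Fintype ι] [DecidableEq ι] {M d : ℕ}
    (hM : (Fintype.card ι + 1) ^ d ≤ M) :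
    ∃ Φ : (ι → Bool) → Fin M → ℝ, ∀ (c : ι → ℝ) (P : Polynomial ℝ), P.natDegree ≤ d →
      ∃ W : Fin M → ℝ, ∀ x, dotProduct W (Φ x) = P.eval (∑ i, c i * ((x i).toNat : ℝ)) := by
  obtain ⟨emb⟩ : Nonempty ((Fin d → Option ι) ↪ Fin M) :=
    Function.Embedding.nonempty_of_card_le (by simpa using hM)
  let ext : (ι → Bool) → Option ι → ℝ := fun x o => o.elim 1 fun i => ((x i).toNat : ℝ)
  let Φ : (ι → Bool) → Fin M → ℝ := fun x =>
    Function.extend emb (fun g => ∏ j, ext x (g j)) 0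
  refine ⟨Φ, fun c P hP => ?_⟩
  have mono : ∀ e : ℕ, e ≤ d →
      ∃ W : Fin M → ℝ, ∀ x, dotProduct W (Φ x) = (∑ i, c i * ((x i).toNat : ℝ)) ^ e := by
    intro e he
    -- The index `none` stands for the constant `1`: the first `e` factors expand to the linear form
    -- and the other `d - e` factors to `1`.
    let coef : Fin d → Option ι → ℝ := fun j o =>
      if (j : ℕ) < e then o.elim 0 c else o.elim 1 fun _ => 0
    refine ⟨Function.extend emb (fun g => ∏ j, coef j (g j)) 0, fun x => ?_⟩
    have h1 : dotProduct (Function.extend emb (fun g => ∏ j, coef j (g j)) 0) (Φ x) =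
        ∑ g : Fin d → Option ι, ∏ j, coef j (g j) * ext x (g j) := by
      symm
      refine Fintype.sum_of_injective emb emb.injective _ _ (fun j hj => ?_) fun g => ?_
      · rw [Function.extend_apply' _ _ _ fun ⟨g, hg⟩ => hj ⟨g, hg⟩]
        simp
      · simp only [Φ]
        rw [emb.injective.extend_apply, emb.injective.extend_apply, Finset.prod_mul_distrib]
    rw [h1, ← Fintype.prod_sum (fun (j : Fin d) (o : Option ι) => coef j o * ext x o)]
    have h2 : ∀ j : Fin d, ∑ o, coef j o * ext x o =
        if (j : ℕ) < e then ∑ i, c i * ((x i).toNat : ℝ) else 1 := by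
      intro j
      rw [Fintype.sum_option]
      by_cases hj : (j : ℕ) < e <;> simp [coef, ext, hj]
    simp only [h2]
    rw [Finset.prod_ite, Finset.prod_const, Finset.prod_const_one, mul_one]
    congr 1
    have : #{j : Fin d | (j : ℕ) < e} = e := by
      rw [Fin.card_filter_val_lt]
      omega
    exact this
  choose! W hW using mono
  refine ⟨∑ e ∈ Finset.range (d + 1), P.coeff e • W e, fun x => ?_⟩
  rw [sum_dotProduct, Polynomial.eval_eq_sum_range' (Nat.lt_succ_of_le hP)]
  refine Finset.sum_congr rfl fun e he => ?_
  rw [smul_dotProduct, hW e (Nat.lt_succ_iff.mp (Finset.mem_range.mp he)), smul_eq_mul]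

/-- The density, with respect to weights that are uniform modulo `4`, of the multiples of `4`. -/
def fourProfile (w : ℕ) : ℝ := if 4 ∣ w then 4 else 0

/-- The mean of a profile over the cube. -/
noncomputable def profileMean {n : ℕ} {κ : Type*} [Fintype κ] [DecidableEq κ] (F : ℕ → ℝ)
    (v : Fin n → κ) : ℝ := 𝔼 x, F (weight v x)

lemma sum_eq_weight {n : ℕ} {κ : Type*} [Fintype κ] [DecidableEq κ] (v : Fin n → κ)
    (x : Fin n × κ → Bool) :
    ∑ c : Fin n × κ, (if v c.1 = c.2 then (1 : ℝ) else 0) * ((x c).toNat : ℝ) = weight v x := by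
  rw [Fintype.sum_prod_type, weight]
  simp

lemma weight_le {n : ℕ} {κ : Type*} (v : Fin n → κ) (x : Fin n × κ → Bool) : weight v x ≤ n := by
  calc weight v x ≤ ∑ _i : Fin n, 1 := Finset.sum_le_sum fun i _ => Bool.toNat_le _
    _ = n := by simp

/-- The polynomial that is negative at the integers in `Z`, and at no other integer. -/
noncomputable def sievePoly (Z : Finset ℕ) : Polynomial ℝ :=
  ∏ z ∈ Z, ((Polynomial.X - Polynomial.C (z : ℝ)) ^ 2 - Polynomial.C (1 / 4))

lemma natDegree_sievePoly_le (Z : Finset ℕ) : (sievePoly Z).natDegree ≤ 2 * #Z := by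
  refine (Polynomial.natDegree_prod_le _ _).trans ?_
  rw [mul_comm, ← smul_eq_mul, ← Finset.sum_const]
  refine Finset.sum_le_sum fun z _ => ?_
  rw [Polynomial.natDegree_sub_C, Polynomial.natDegree_pow, Polynomial.natDegree_X_sub_C]

lemma eval_sievePoly (Z : Finset ℕ) (w : ℕ) :
    (sievePoly Z).eval (w : ℝ) = ∏ z ∈ Z, (((w : ℝ) - z) ^ 2 - 1 / 4) := by
  simp [sievePoly, Polynomial.eval_prod]

lemma sub_sq_pos_of_ne {w z : ℕ} (h : w ≠ z) : 0 < ((w : ℝ) - z) ^ 2 - 1 / 4 := by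
  have h1 : (1 : ℤ) ≤ ((w : ℤ) - z) ^ 2 := by
    have : (w : ℤ) - z ≠ 0 := by omega
    have := Int.one_le_abs this
    rw [← sq_abs]
    nlinarith
  have h2 : (1 : ℝ) ≤ ((w : ℝ) - z) ^ 2 := by exact_mod_cast h1
  linarith

/-- At an integer `w` the factor of `z` is `-1 / 4` if `w = z` and at least `3 / 4` otherwise, so at
most one factor is negative. -/
lemma signLabel_sievePoly (Z : Finset ℕ) (w : ℕ) :
    signLabel ((sievePoly Z).eval (w : ℝ)) = if w ∈ Z then -1 else 1 := by
  rw [eval_sievePoly]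
  split_ifs with h
  · have : ∏ z ∈ Z, (((w : ℝ) - z) ^ 2 - 1 / 4) < 0 := by
      rw [← Finset.mul_prod_erase Z _ h]
      have : 0 < ∏ z ∈ Z.erase w, (((w : ℝ) - z) ^ 2 - 1 / 4) :=
        Finset.prod_pos fun z hz => sub_sq_pos_of_ne (Finset.ne_of_mem_erase hz).symm
      nlinarith
    rw [signLabel, if_neg (not_le.mpr this)]
  · have : 0 ≤ ∏ z ∈ Z, (((w : ℝ) - z) ^ 2 - 1 / 4) :=
      Finset.prod_nonneg fun z hz => (sub_sq_pos_of_ne fun e => h (by rwa [e])).le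
    rw [signLabel, if_pos this]

/-- The law prescribed by its two label densities is rewritten as a halfspace with noise: the
marginal is the sum of the densities, and the noise rate is the conditional probability of the label
that the halfspace rejects. The features `Φ` do not depend on `v`, so all instances share the same
points. -/
lemma exists_instance {n M d : ℕ} {κ : Type*} [Fintype κ] [DecidableEq κ]
    (Φ : (Fin n × κ → Bool) → Fin M → ℝ)
    (hΦ : ∀ (c : Fin n × κ → ℝ) (P : Polynomial ℝ), P.natDegree ≤ d →
      ∃ W : Fin M → ℝ, ∀ x, dotProduct W (Φ x) = P.eval (∑ i, c i * ((x i).toNat : ℝ)))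
    (Z : Finset ℕ) (hZd : 2 * #Z ≤ d) (hd : 1 ≤ d)
    (a : ℕ → ℝ) (ha0 : ∀ w, 0 ≤ a w) (haZ : ∀ z ∈ Z, a z = 0)
    (ha1 : ∀ w ≤ n, 4 ∣ w → w ∉ Z → a w = 1) (v : Fin n → κ) {η opt : ℝ} (hη : 0 < η)
    (hη2 : η < 1 / 2) (hEa : |profileMean a v - 1| ≤ 1 / 4)
    (hEb : |profileMean fourProfile v - 1| ≤ 1 / 4)
    (htail : (𝔼 x, if 4 ∣ weight v x ∧ weight v x ∉ Z then (1 : ℝ) else 0) ≤ opt) :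
    ∃ D : Measure (Example M), IsProbabilityMeasure D ∧ IsMassartHalfspace η D ∧
      optError D ≤ ENNReal.ofReal opt ∧ ∀ f : SQuery M, ∫ z, f.toFun z ∂D =
        𝔼 x, ((1 - η / 16) * (a (weight v x) / profileMean a v) * f.toFun (Φ x, 1) +
          η / 16 * (fourProfile (weight v x) / profileMean fourProfile v) *
            f.toFun (Φ x, -1)) := by
  set Ea := profileMean a v with hEadef
  set Eb := profileMean fourProfile v with hEbdef
  obtain ⟨hEa1, hEa2⟩ := abs_le.mp hEa
  obtain ⟨hEb1, hEb2⟩ := abs_le.mp hEb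
  have hEa0 : 0 < Ea := by linarith
  have hEb0 : 0 < Eb := by linarith
  set p : ℝ := η / 16 with hp
  have hp0 : 0 < p := by positivity
  have hp1 : p < 1 / 32 := by rw [hp]; linarith
  obtain ⟨W₁, hW₁⟩ := hΦ (fun c => if v c.1 = c.2 then 1 else 0) (sievePoly Z)
    ((natDegree_sievePoly_le Z).trans hZd)
  obtain ⟨W₀, hW₀⟩ := hΦ (fun c => if v c.1 = c.2 then 1 else 0) Polynomial.X
    (by rw [Polynomial.natDegree_X]; exact hd)
  simp only [sum_eq_weight, Polynomial.eval_X] at hW₁ hW₀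
  set f : (Fin M → ℝ) → ℤˣ := fun t => signLabel (dotProduct W₁ t - 0) with hfdef
  have hf : IsHalfspace f := ⟨W₁, 0, fun _ => rfl⟩
  have hfm : Measurable f := measurable_of_isHalfspace hf
  have hfΦ : ∀ x, f (Φ x) = if weight v x ∈ Z then -1 else 1 := by
    intro x
    rw [hfdef]
    simp only [sub_zero, hW₁, signLabel_sievePoly]
  -- The conditional probability of `-1` at a multiple of `4` outside `Z`, where the profiles are
  -- `4` and `a = 1`. The means lie in `[3/4, 5/4]`, so `p = η / 16` is small enough for `r ≤ η`.
  set r : ℝ := p * (4 / Eb) / (p * (4 / Eb) + (1 - p) / Ea) with hr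
  have hden : 0 < p * (4 / Eb) + (1 - p) / Ea := by
    have : 0 < (1 - p) / Ea := div_pos (by linarith) hEa0
    positivity
  have hr0 : 0 ≤ r := by positivity
  have hrη : r ≤ η := by
    rw [hr, div_le_iff₀ hden]
    have h1 : p * (4 / Eb) ≤ p * 6 := by
      gcongr
      rw [div_le_iff₀ hEb0]; linarith
    have h2 : η * (1 / 2) ≤ η * ((1 - p) / Ea) := by
      refine mul_le_mul_of_nonneg_left ?_ hη.le
      rw [le_div_iff₀ hEa0]; linarith
    have h3 : 0 ≤ η * (p * (4 / Eb)) := by positivity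
    rw [mul_add]
    linarith
  set T : Set ℝ := ((fun w : ℕ => (w : ℝ)) '' {w | w ≤ n ∧ 4 ∣ w ∧ w ∉ Z}) with hT
  have hTfin : T.Finite := ((Set.finite_Iic n).subset fun w hw => hw.1).image _
  -- The noise must be a function on `ℝ^M`. The weight is itself a linear functional `W₀` of the
  -- features, which is why `1 ≤ d` is needed.
  set ρ : (Fin M → ℝ) → ℝ := fun t => T.indicator (fun _ => r) (dotProduct W₀ t) with hρdef
  have hρ : Measurable ρ := by
    refine (measurable_const.indicator hTfin.measurableSet).comp ?_
    unfold dotProduct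
    fun_prop
  have hρ0 : ∀ t, 0 ≤ ρ t := fun t => Set.indicator_nonneg (fun _ _ => hr0) _
  have hρη : ∀ t, ρ t ≤ η := fun t =>
    Set.indicator_apply_le' (fun _ => hrη) (fun _ => hη.le)
  have hρΦ : ∀ x, ρ (Φ x) = if 4 ∣ weight v x ∧ weight v x ∉ Z then r else 0 := by
    intro x
    have : ((weight v x : ℕ) : ℝ) ∈ T ↔ 4 ∣ weight v x ∧ weight v x ∉ Z := by
      rw [hT]
      constructor
      · rintro ⟨w, hw, h⟩
        have h : w = weight v x := Nat.cast_injective h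
        exact h ▸ hw.2
      · exact fun h => ⟨_, ⟨weight_le v x, h⟩, rfl⟩
    simp only [hρdef, hW₀]
    split_ifs with h
    · exact Set.indicator_of_mem (this.mpr h) _
    · exact Set.indicator_of_notMem (fun h' => h (this.mp h')) _
  set m : (Fin n × κ → Bool) → ℝ := fun x =>
    ((1 - p) * (a (weight v x) / Ea) + p * (fourProfile (weight v x) / Eb)) /
      Fintype.card (Fin n × κ → Bool) with hm
  have hb0 : ∀ w, 0 ≤ fourProfile w := by
    intro w; rw [fourProfile]; split_ifs <;> norm_num
  have hm0 : ∀ x, 0 ≤ m x := by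
    intro x
    have h1 : 0 ≤ 1 - p := by linarith
    have h2 := ha0 (weight v x)
    have h3 := hb0 (weight v x)
    positivity
  have hm1 : ∑ x, m x = 1 := by
    rw [hm, ← Finset.sum_div, ← Fintype.expect_eq_sum_div_card, Finset.expect_add_distrib,
      ← Finset.mul_expect, ← Finset.mul_expect, ← Finset.expect_div, ← Finset.expect_div]
    change (1 - p) * (Ea / Ea) + p * (Eb / Eb) = 1
    rw [div_self hEa0.ne', div_self hEb0.ne']
    ring
  have hDx := isProbabilityMeasure_finiteLaw Φ hm0 hm1
  have hρ1 : ∀ t, ρ t ≤ 1 := fun t => (hρη t).trans (by linarith)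
  have hprob := isProbabilityMeasure_noisyLaw (finiteLaw Φ m) hfm hρ hρ0 hρ1
  have hquery : ∀ φ : SQuery M, ∫ z, φ.toFun z ∂(noisyLaw (finiteLaw Φ m) f ρ) =
      𝔼 x, ((1 - p) * (a (weight v x) / Ea) * φ.toFun (Φ x, 1) +
        p * (fourProfile (weight v x) / Eb) * φ.toFun (Φ x, -1)) := by
    intro φ
    rw [integral_noisyLaw _ hfm hρ hρ0 hρ1, integral_finiteLaw Φ hm0,
      Fintype.expect_eq_sum_div_card, Finset.sum_div]
    refine Finset.sum_congr rfl fun x _ => ?_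
    rw [hρΦ, hfΦ]
    simp only [hm]
    rw [div_mul_eq_mul_div]
    congr 1
    by_cases hxZ : weight v x ∈ Z
    · simp only [hxZ, not_true_eq_false, and_false, if_false, if_true, haZ _ hxZ]
      ring
    · by_cases h4 : 4 ∣ weight v x
      · have h5 : fourProfile (weight v x) = 4 := if_pos h4
        simp only [hxZ, h4, not_false_eq_true, and_true, if_false, if_true, h5,
          ha1 _ (weight_le v x) h4 hxZ]
        have h6 : r * (p * (4 / Eb) + (1 - p) / Ea) = p * (4 / Eb) := by
          rw [hr, div_mul_cancel₀ _ hden.ne']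
        have h7 : (1 - p) * (1 / Ea) = (1 - p) / Ea := by ring
        rw [h7]
        linear_combination (φ.toFun (Φ x, -1) - φ.toFun (Φ x, 1)) * h6
      · have h5 : fourProfile (weight v x) = 0 := if_neg h4
        simp only [hxZ, h4, false_and, if_false, h5]
        ring
  refine ⟨noisyLaw (finiteLaw Φ m) f ρ, hprob,
    ⟨finiteLaw Φ m, f, ρ, hDx, hf, hρ, fun t => ⟨hρ0 t, (hρη t).trans hη2.le, hρη t⟩, rfl⟩, ?_,
    hquery⟩
  refine (iInf₂_le f hf).trans ?_
  rw [misclassification_eq _ hfm, hquery]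
  refine ENNReal.ofReal_le_ofReal (le_trans (Finset.expect_le_expect fun x _ => ?_) htail)
  simp only [errorQuery_apply, hfΦ]
  have hne : (-1 : ℤˣ) ≠ 1 := by decide
  by_cases hxZ : weight v x ∈ Z
  · simp [hxZ, haZ _ hxZ]
  · by_cases h4 : 4 ∣ weight v x
    · have h5 : fourProfile (weight v x) = 4 := if_pos h4
      have h6 : p * (4 / Eb) ≤ 1 := by
        have : 4 / Eb ≤ 6 := by rw [div_le_iff₀ hEb0]; linarith
        nlinarith
      simp [hxZ, h4, h5, hne.symm]
      exact h6
    · have h5 : fourProfile (weight v x) = 0 := if_neg h4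
      simp [hxZ, h4, h5]

/-! ### Normalized correlations and numerical estimates. -/

lemma HighFrequency.mono {F : ℕ → ℝ} {C C' : ℝ} (h : HighFrequency F C) (hC : C ≤ C') :
    HighFrequency F C' := by
  obtain ⟨J, i, c, ζ, h1, h2, h3, h4⟩ := h
  exact ⟨J, i, c, ζ, h1, h2, h3, h4.trans hC⟩

/-- Centering at the true means costs the product of the two mean errors, at most `C ^ 2 * (1 / 2) ^
n`. This is no worse than the correlation bound, since a Hamming distance is at most `n`. -/
lemma HighFrequency.abs_expect_normalized_le {F : ℕ → ℝ} {C : ℝ} (hF : HighFrequency F C)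
    {n : ℕ} {κ : Type*} [Fintype κ] [DecidableEq κ] (hC : C * (√2 / 2) ^ n ≤ 1 / 4)
    (u v : Fin n → κ) :
    |𝔼 x, (F (weight u x) / profileMean F u - 1) * (F (weight v x) / profileMean F v - 1)| ≤
      4 * C ^ 2 * (1 / 2) ^ hammingDist u v := by
  have hu := hF.abs_expect_sub_one_le u
  have hv := hF.abs_expect_sub_one_le v
  have huv := hF.abs_expect_mul_le u v
  change |profileMean F u - 1| ≤ _ at hu
  change |profileMean F v - 1| ≤ _ at hv
  have hu1 := (abs_le.mp (hu.trans hC)).1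
  have hv1 := (abs_le.mp (hv.trans hC)).1
  set Eu := profileMean F u with hEu
  set Ev := profileMean F v with hEv
  have hu0 : 0 < Eu := by linarith
  have hv0 : 0 < Ev := by linarith
  have e : 𝔼 x, (F (weight u x) / Eu - 1) * (F (weight v x) / Ev - 1) =
      (𝔼 x, (F (weight u x) - 1) * (F (weight v x) - 1) - (Eu - 1) * (Ev - 1)) / (Eu * Ev) := by
    have h1 : ∀ x, (F (weight u x) / Eu - 1) * (F (weight v x) / Ev - 1) =
        ((F (weight u x) - 1) * (F (weight v x) - 1) - (Ev - 1) * F (weight u x) -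
          (Eu - 1) * F (weight v x) + (Eu * Ev - 1)) / (Eu * Ev) := by
      intro x
      field_simp
      ring
    simp only [h1]
    rw [← Finset.expect_div, Finset.expect_add_distrib, Finset.expect_sub_distrib,
      Finset.expect_sub_distrib, ← Finset.mul_expect, ← Finset.mul_expect, Fintype.expect_const]
    change (_ - (Ev - 1) * Eu - (Eu - 1) * Ev + (Eu * Ev - 1)) / _ = _
    congr 1
    ring
  rw [e, abs_div, abs_of_pos (mul_pos hu0 hv0), div_le_iff₀ (mul_pos hu0 hv0)]
  have hd : hammingDist u v ≤ n := by simpa using hammingDist_le_card_fintype (x := u) (y := v)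
  have hmean : |(Eu - 1) * (Ev - 1)| ≤ C ^ 2 * (1 / 2) ^ hammingDist u v := by
    rw [abs_mul]
    calc |Eu - 1| * |Ev - 1| ≤ (C * (√2 / 2) ^ n) * (C * (√2 / 2) ^ n) :=
          mul_le_mul hu hv (abs_nonneg _) ((abs_nonneg _).trans hu)
      _ = C ^ 2 * (1 / 2) ^ n := by
          have h2 : √2 / 2 * (√2 / 2) = 1 / 2 := by
            have : √2 * √2 = 2 := Real.mul_self_sqrt (by norm_num)
            linarith
          rw [← h2, mul_pow]
          ring
      _ ≤ _ := mul_le_mul_of_nonneg_left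
          (pow_le_pow_of_le_one (by norm_num) (by norm_num) hd) (sq_nonneg C)
  have h9 : 1 / 2 ≤ Eu * Ev := by nlinarith
  have hnn : 0 ≤ C ^ 2 * (1 / 2) ^ hammingDist u v := by positivity
  calc |𝔼 x, (F (weight u x) - 1) * (F (weight v x) - 1) - (Eu - 1) * (Ev - 1)|
      ≤ C ^ 2 * (1 / 2) ^ hammingDist u v + C ^ 2 * (1 / 2) ^ hammingDist u v :=
        (abs_sub _ _).trans (add_le_add huv hmean)
    _ ≤ _ := by nlinarith

/-- The multiples of `4` within distance `L` of `n / 2`. -/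
noncomputable def sieveSet (n : ℕ) (L : ℝ) : Finset ℕ :=
  {z ∈ Finset.range (n + 1) | 4 ∣ z ∧ |(z : ℝ) - n / 2| ≤ L}

/-- An interval of length `2 * L` has at most `L / 2 + 1` multiples of `4`; the left side bounds the
degree of the sieve polynomial. -/
lemma two_mul_card_sieveSet_le (n : ℕ) {L : ℝ} (hL : 0 ≤ L) :
    (2 * #(sieveSet n L) : ℝ) ≤ L + 2 := by
  set lo : ℤ := ⌈((n : ℝ) / 2 - L) / 4⌉ with hlo
  set hi : ℤ := ⌊((n : ℝ) / 2 + L) / 4⌋ with hhi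
  have h1 : #(sieveSet n L) ≤ #(Finset.Icc lo hi) := by
    refine Finset.card_le_card_of_injOn (fun z : ℕ => ((z / 4 : ℕ) : ℤ)) ?_ ?_
    · intro z hz
      simp only [sieveSet, Finset.coe_filter, Set.mem_ofPred_eq] at hz
      obtain ⟨-, ⟨y, rfl⟩, hz⟩ := hz
      obtain ⟨h2, h3⟩ := abs_le.mp hz
      simp only [Nat.mul_div_cancel_left y (show 0 < 4 by norm_num),
        Finset.coe_Icc, Set.mem_Icc, hlo, hhi, Int.ceil_le, Int.le_floor]
      push_cast at h2 h3 ⊢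
      constructor <;> linarith
    · intro z hz z' hz' h
      simp only [sieveSet, Finset.coe_filter, Set.mem_ofPred_eq] at hz hz'
      have h : z / 4 = z' / 4 := Nat.cast_injective (R := ℤ) h
      omega
  rw [Int.card_Icc] at h1
  have h2 : ((hi : ℝ)) ≤ ((n : ℝ) / 2 + L) / 4 := Int.floor_le _
  have h3 : ((n : ℝ) / 2 - L) / 4 ≤ lo := Int.le_ceil _
  have h4 : (((hi + 1 - lo).toNat : ℤ) : ℝ) ≤ L / 2 + 1 := by
    rcases le_total 0 (hi + 1 - lo) with h | h
    · rw [Int.toNat_of_nonneg h]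
      push_cast
      linarith
    · rw [Int.toNat_of_nonpos h]
      simp
      linarith
  have h5 : (#(sieveSet n L) : ℝ) ≤ ((hi + 1 - lo).toNat : ℝ) := by exact_mod_cast h1
  have h6 : (((hi + 1 - lo).toNat : ℤ) : ℝ) = ((hi + 1 - lo).toNat : ℝ) := by norm_cast
  linarith

/-- The power of `1 / 2` decays like `exp (-0.34 n)`, the polynomial factor costs at most `exp (0.2
n)`, and the remaining `0.14` exceeds `2 / 16`. -/
lemma sq_mul_half_pow_le {n : ℕ} (hn : 2000 ≤ n) :
    8 * ((n : ℝ) + 1) ^ 2 * (1 / 2) ^ (n - n / 2) ≤ Real.exp (-(n / 16)) ^ 2 := by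
  have hn' : (2000 : ℝ) ≤ n := by exact_mod_cast hn
  have h1 : ((1 : ℝ) / 2) ^ (n - n / 2) ≤ Real.exp (-(n * 0.34)) := by
    have h2 : (1 : ℝ) / 2 ≤ Real.exp (-0.68) := by
      rw [one_div, Real.exp_neg]
      refine inv_anti₀ (Real.exp_pos _) ?_
      have := Real.exp_log (show (0 : ℝ) < 2 by norm_num)
      rw [← this, Real.exp_le_exp]
      linarith [Real.log_two_gt_d9]
    calc ((1 : ℝ) / 2) ^ (n - n / 2) ≤ Real.exp (-0.68) ^ (n - n / 2) := by gcongr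
      _ = Real.exp (((n - n / 2 : ℕ) : ℝ) * (-0.68)) := by rw [Real.exp_nat_mul]
      _ ≤ _ := by
        rw [Real.exp_le_exp]
        have : (n : ℝ) ≤ 2 * ((n - n / 2 : ℕ) : ℝ) := by
          have : n ≤ 2 * (n - n / 2) := by omega
          exact_mod_cast this
        linarith
  have h3 : 8 * ((n : ℝ) + 1) ^ 2 ≤ Real.exp (n * 0.2) := by
    have h4 : (n : ℝ) / 20 + 1 ≤ Real.exp (n / 20) := Real.add_one_le_exp _
    calc 8 * ((n : ℝ) + 1) ^ 2 ≤ ((n : ℝ) / 20 + 1) ^ 4 := by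
          have h5 : 3 * ((n : ℝ) + 1) ≤ ((n : ℝ) / 20 + 1) ^ 2 := by nlinarith
          calc 8 * ((n : ℝ) + 1) ^ 2 ≤ (3 * ((n : ℝ) + 1)) ^ 2 := by nlinarith
            _ ≤ (((n : ℝ) / 20 + 1) ^ 2) ^ 2 := by gcongr
            _ = _ := by ring
      _ ≤ Real.exp (n / 20) ^ 4 := by gcongr
      _ = _ := by rw [← Real.exp_nat_mul]; congr 1; push_cast; ring
  calc 8 * ((n : ℝ) + 1) ^ 2 * (1 / 2) ^ (n - n / 2)
      ≤ Real.exp (n * 0.2) * Real.exp (-(n * 0.34)) := by gcongr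
    _ ≤ Real.exp (-(n / 16)) ^ 2 := by
        rw [← Real.exp_add, ← Real.exp_nat_mul, Real.exp_le_exp]
        push_cast
        linarith

lemma abs_div_sub_one_le {a E : ℝ} (ha0 : 0 ≤ a) (ha : a ≤ 4) (hE : |E - 1| ≤ 1 / 4) :
    |a / E - 1| ≤ 8 := by
  have h := (abs_le.mp hE).1
  have hE0 : 0 < E := by linarith
  have h1 : 0 ≤ a / E := by positivity
  have h2 : a / E ≤ 6 := by rw [div_le_iff₀ hE0]; linarith
  rw [abs_le]
  constructor <;> linarith

/-! ### The lower bound for given parameters. -/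

theorem not_learns {M n d q : ℕ} [Fact q.Prime] (hn : 2000 ≤ n) (hnq : n ≤ q)
    (hM : (n * q + 1) ^ d ≤ M) {L opt η τ : ℝ} (hL : 0 ≤ L) (hLd : L + 2 ≤ d)
    (hopt : 2 * Real.exp (-(2 * L ^ 2 / n)) ≤ opt) (hη : 0 < η) (hη2 : η < 1 / 2)
    (hτn : Real.exp (-(n / 16)) ≤ τ) (hτη : τ ≤ η / 32)
    {Ω : Type*} [MeasurableSpace Ω] (μ : Measure Ω) [IsProbabilityMeasure μ]
    (A : Ω → SQAlgorithm M) {Q : ℕ} (hQ : (Q : ℝ) ≤ 1 / τ) (hA : ∀ ω, (A ω).QueriesAtMost Q) :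
    ¬ LearnsMassartHalfspaces μ A η opt τ (1 / 32 * η) := by
  have hn' : (2000 : ℝ) ≤ n := by exact_mod_cast hn
  have hτ : 0 < τ := (Real.exp_pos _).trans_le hτn
  set Z := sieveSet n L with hZdef
  have hZ : ∀ z ∈ Z, 4 ∣ z ∧ z ≤ n := by
    intro z hz
    simp only [hZdef, sieveSet, Finset.mem_filter, Finset.mem_range] at hz
    exact ⟨hz.2.1, by omega⟩
  have hZn : #Z ≤ n + 1 := by
    rw [hZdef, sieveSet]
    exact (Finset.card_filter_le _ _).trans (by simp)
  have hZd : 2 * #Z ≤ d := by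
    have := two_mul_card_sieveSet_le n hL
    have h : (2 * #Z : ℝ) ≤ d := by linarith
    exact_mod_cast h
  have hd : 1 ≤ d := by
    have h : (1 : ℝ) ≤ d := by linarith
    exact_mod_cast h
  obtain ⟨a, haF, ha0, ha2, haZ, ha1⟩ := exists_profile n Z hZ
  -- Messages of length `n / 2` balance the number `q ^ (n / 2)` of words against a distance of at
  -- least `n - n / 2`.
  obtain ⟨V, hV⟩ := exists_code hnq (n / 2)
  obtain ⟨Φ, hΦ⟩ := exists_features (ι := Fin n × ZMod q) (M := M) (d := d)
    (by simpa [ZMod.card] using hM)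
  have hpow := sq_mul_half_pow_le hn
  have hpowτ : 4 * ((n : ℝ) + 1) ^ 2 * (1 / 2) ^ (n - n / 2) ≤ τ ^ 2 / 2 := by
    have : Real.exp (-(n / 16)) ^ 2 ≤ τ ^ 2 := by gcongr
    linarith
  have hC : ((n : ℝ) + 1) * (√2 / 2) ^ n ≤ 1 / 4 := by
    refine (sq_le_sq₀ (by positivity) (by norm_num)).mp ?_
    have h2 : (√2 / 2) ^ 2 = 1 / 2 := by
      rw [div_pow, Real.sq_sqrt (by norm_num)]; norm_num
    rw [mul_pow, ← pow_mul, mul_comm n 2, pow_mul, h2]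
    have h3 : ((1 : ℝ) / 2) ^ n ≤ (1 / 2) ^ (n - n / 2) :=
      pow_le_pow_of_le_one (by norm_num) (by norm_num) (Nat.sub_le _ _)
    have h4 : τ ≤ 1 / 64 := by linarith
    nlinarith [sq_nonneg ((n : ℝ) + 1)]
  have haF' : HighFrequency a ((n : ℝ) + 1) := haF.mono (by exact_mod_cast hZn)
  have hbF' : HighFrequency fourProfile ((n : ℝ) + 1) := highFrequency_four_dvd.mono (by linarith)
  have hmean : ∀ F : ℕ → ℝ, HighFrequency F ((n : ℝ) + 1) → ∀ v : Fin n → ZMod q,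
      |profileMean F v - 1| ≤ 1 / 4 := by
    intro F hF v
    exact (hF.abs_expect_sub_one_le v).trans hC
  have hcorr : ∀ F : ℕ → ℝ, HighFrequency F ((n : ℝ) + 1) → ∀ c c', c ≠ c' →
      |𝔼 x, (F (weight (V c) x) / profileMean F (V c) - 1) *
        (F (weight (V c') x) / profileMean F (V c') - 1)| ≤
        4 * ((n : ℝ) + 1) ^ 2 * (1 / 2) ^ (n - n / 2) := by
    intro F hF c c' hcc
    refine (hF.abs_expect_normalized_le hC (V c) (V c')).trans ?_
    refine mul_le_mul_of_nonneg_left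
      (pow_le_pow_of_le_one (by norm_num) (by norm_num) ?_) (by positivity)
    have := hV c c' hcc
    omega
  have htail : ∀ v : Fin n → ZMod q,
      (𝔼 x, if 4 ∣ weight v x ∧ weight v x ∉ Z then (1 : ℝ) else 0) ≤ opt := by
    intro v
    refine le_trans (Finset.expect_le_expect fun x _ => ?_)
      ((expect_weight_tail_le (by omega) v hL).trans hopt)
    by_cases h : 4 ∣ weight v x ∧ weight v x ∉ Z
    · have h1 : L < |(weight v x : ℝ) - n / 2| := by
        by_contra h2
        apply h.2
        simp only [hZdef, sieveSet, Finset.mem_filter, Finset.mem_range]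
        exact ⟨Nat.lt_succ_of_le (weight_le v x), h.1, not_lt.mp h2⟩
      simp [h, h1]
    · rw [if_neg h]
      positivity
  choose D hDp hDM hDo hDq using fun c => exists_instance Φ hΦ Z hZd hd a ha0 haZ ha1 (V c) hη hη2
    (hmean a haF' (V c)) (hmean _ hbF' (V c)) (htail (V c))
  set p : ℝ := η / 16 with hp
  have hp0 : 0 ≤ p := by positivity
  have hp1 : p ≤ 1 / 32 := by rw [hp]; linarith
  -- The reference law: `x` uniform on the cube and, independently, label `-1` with probability `p`.
  set E₀ : SQuery M → ℝ := fun f => 𝔼 x, ((1 - p) * f.toFun (Φ x, 1) + p * f.toFun (Φ x, -1))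
    with hE₀
  have hbad : ∀ f : SQuery M,
      #{c | τ < |∫ z, f.toFun z ∂(D c) - E₀ f|} ≤ ⌊2 * 8 ^ 2 / τ ^ 2⌋₊ := by
    intro f
    apply Nat.le_floor
    have hf : ∀ z, |f.toFun z| ≤ 1 := fun z => abs_le.mpr (f.mem_Icc z)
    have h4 : ∀ w, fourProfile w ≤ 4 := by intro w; rw [fourProfile]; split_ifs <;> norm_num
    have h0 : ∀ w, 0 ≤ fourProfile w := by intro w; rw [fourProfile]; split_ifs <;> norm_num
    refine card_correlated_le
      (α := fun c x => a (weight (V c) x) / profileMean a (V c) - 1)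
      (β := fun c x => fourProfile (weight (V c) x) / profileMean fourProfile (V c) - 1)
      (φ := fun x => f.toFun (Φ x, 1)) (ψ := fun x => f.toFun (Φ x, -1)) (p := p)
      (fun c x => abs_div_sub_one_le (ha0 _) ((ha2 _).trans (by norm_num)) (hmean a haF' _))
      (fun c x => abs_div_sub_one_le (h0 _) (h4 _) (hmean _ hbF' _))
      (hcorr a haF') (hcorr _ hbF') (by positivity) hp0 (by linarith) hτ hpowτ
      (fun x => hf _) (fun x => hf _) _ fun c hc => ?_
    rw [Finset.mem_filter] at hc
    refine hc.2.trans_le (le_of_eq ?_)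
    congr 1
    rw [hDq, hE₀, ← Finset.expect_sub_distrib, Finset.mul_expect, Finset.mul_expect,
      ← Finset.expect_add_distrib]
    exact Finset.expect_congr rfl fun x _ => by ring
  refine not_learns_of_family D hDp E₀ hDM hDo hτ.le hbad ?_ μ A hA ?_
  · intro h hh
    -- Pointwise, a hypothesis errs with probability `p` or `1 - p` under the reference law; half of
    -- `p = η / 16` is left for the tolerance.
    have h1 : 1 / 32 * η + τ ≤ p := by rw [hp]; linarith
    refine h1.trans ?_
    calc p = 𝔼 _x : Fin n × ZMod q → Bool, p := (Fintype.expect_const _).symm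
      _ ≤ _ := by
        refine Finset.expect_le_expect fun x _ => ?_
        have hne : (-1 : ℤˣ) ≠ 1 := by decide
        rw [errorQuery_apply, errorQuery_apply]
        rcases Int.units_eq_one_or (h (Φ x)) with h2 | h2
        · simp [h2, hne.symm]
        · simp [h2, hne]
          linarith
  · have hcardI : Fintype.card (Fin (n / 2) → ZMod q) = q ^ (n / 2) := by simp [ZMod.card]
    rw [hcardI]
    have hτ1 : τ ≤ 1 := by linarith
    have h1 : ((Q : ℝ) + 1) ≤ 2 / τ := by
      have : 1 ≤ 1 / τ := by rw [le_div_iff₀ hτ]; linarith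
      have e : 2 / τ = 1 / τ + 1 / τ := by ring
      linarith
    have h2 : ((⌊2 * 8 ^ 2 / τ ^ 2⌋₊ : ℕ) : ℝ) ≤ 128 / τ ^ 2 :=
      (Nat.floor_le (by positivity)).trans (by norm_num)
    -- The exceptional indices number `O(1 / τ ^ 3)`, at most of order `exp (3 n / 16)`, far below
    -- the number of words, which is at least `exp (n - 2)`.
    have h3 : 3 * (((Q : ℝ) + 1) * ((⌊2 * 8 ^ 2 / τ ^ 2⌋₊ : ℕ) : ℝ)) ≤ 768 * (1 / τ) ^ 3 := by
      calc 3 * (((Q : ℝ) + 1) * ((⌊2 * 8 ^ 2 / τ ^ 2⌋₊ : ℕ) : ℝ))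
          ≤ 3 * (2 / τ * (128 / τ ^ 2)) := by gcongr
        _ = _ := by field_simp; norm_num
    have h4 : (1 / τ) ^ 3 ≤ Real.exp (n / 5) := by
      have : 1 / τ ≤ Real.exp (n / 16) := by
        rw [div_le_iff₀ hτ]
        calc (1 : ℝ) = Real.exp (n / 16) * Real.exp (-(n / 16)) := by
              rw [← Real.exp_add]; simp
          _ ≤ _ := by gcongr
      calc (1 / τ) ^ 3 ≤ Real.exp (n / 16) ^ 3 := by gcongr
        _ = Real.exp (3 * (n / 16)) := by rw [← Real.exp_nat_mul]; norm_num
        _ ≤ _ := by rw [Real.exp_le_exp]; linarith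
    have h5 : Real.exp (n - 2) ≤ (q : ℝ) ^ (n / 2) := by
      have he : Real.exp 2 ≤ q := by
        have h6 : Real.exp 2 = Real.exp 1 ^ 2 := by rw [← Real.exp_nat_mul]; norm_num
        have h7 : (n : ℝ) ≤ q := by exact_mod_cast hnq
        rw [h6]
        nlinarith [Real.exp_one_lt_d9, Real.exp_pos 1]
      calc Real.exp (n - 2) ≤ Real.exp (((n / 2 : ℕ) : ℝ) * 2) := by
            rw [Real.exp_le_exp]
            have : n ≤ (n / 2) * 2 + 2 := by omega
            have : (n : ℝ) ≤ ((n / 2 : ℕ) : ℝ) * 2 + 2 := by exact_mod_cast this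
            linarith
        _ = Real.exp 2 ^ (n / 2) := by rw [Real.exp_nat_mul]
        _ ≤ _ := by gcongr
    have h6 : 768 * Real.exp (n / 5) < 2 * Real.exp (n - 2) := by
      have h7 : Real.exp (n - 2) = Real.exp (n / 5) * Real.exp (n * 4 / 5 - 2) := by
        rw [← Real.exp_add]; congr 1; ring
      have h8 : (n : ℝ) * 4 / 5 - 2 + 1 ≤ Real.exp (n * 4 / 5 - 2) := Real.add_one_le_exp _
      rw [h7]
      nlinarith [Real.exp_pos ((n : ℝ) / 5)]
    have h9 : (3 * (((Q : ℝ) + 1) * ((⌊2 * 8 ^ 2 / τ ^ 2⌋₊ : ℕ) : ℝ))) < 2 * (q : ℝ) ^ (n / 2) := by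
      linarith
    exact_mod_cast h9

/-! ### Choice of parameters. -/

/-- For `M ≥ 3` the iterated logarithm is bounded below by `log (log 3) > 0`, so a large enough `K`
forces `log M ≥ exp 1000`. The summand `1 / κ ^ 3` in `K` compensates for the smallness of that
bound. -/
lemma exists_const_of_log_le : ∃ K : ℝ, 1000 ≤ K ∧ ∀ (M : ℕ) (l : ℝ), Real.log 2 ≤ l →
    K * l ≤ Real.log M / Real.log (Real.log M) ^ 3 → 1000 ≤ Real.log (Real.log M) := by
  have h3 : 1 < Real.log 3 := by
    rw [Real.lt_log_iff_exp_lt (by norm_num)]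
    linarith [Real.exp_one_lt_d9]
  set κ := Real.log (Real.log 3) with hκ
  have hκ0 : 0 < κ := Real.log_pos h3
  have he : (1000 : ℝ) + 1 ≤ Real.exp 1000 := Real.add_one_le_exp _
  refine ⟨2 * Real.exp 1000 * (1 + 1 / κ ^ 3), ?_, fun M l hl h => ?_⟩
  · have : 0 < 1 / κ ^ 3 := by positivity
    nlinarith
  set K := 2 * Real.exp 1000 * (1 + 1 / κ ^ 3) with hK
  have hl2 := Real.log_two_gt_d9
  have hK0 : 0 < K := by positivity
  have hKl : 0 < K * l := by nlinarith
  have hM : 3 ≤ M := by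
    by_contra hM
    have hM : M < 3 := not_le.mp hM
    -- For `M = 0, 1` the conventions for `log 0` and division by zero make the quotient `0`; for `M
    -- = 2` the iterated logarithm is negative. Both contradict `0 < K * l`.
    interval_cases M
    · simp at h; linarith
    · simp at h; linarith
    · have h1 : Real.log (Real.log (2 : ℕ)) ≤ 0 :=
        Real.log_nonpos (Real.log_nonneg (by norm_num)) (by push_cast; linarith [Real.log_two_lt_d9])
      have h2 : Real.log (Real.log (2 : ℕ)) ^ 3 ≤ 0 := Odd.pow_nonpos (by decide) h1
      have h4 : 0 ≤ Real.log (2 : ℕ) := Real.log_nonneg (by norm_num)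
      have := div_nonpos_of_nonneg_of_nonpos h4 h2
      linarith
  have hM3 : Real.log 3 ≤ Real.log M := Real.log_le_log (by norm_num) (by exact_mod_cast hM)
  have hlam : κ ≤ Real.log (Real.log M) := Real.log_le_log (by linarith) hM3
  have hκ3 : κ ^ 3 ≤ Real.log (Real.log M) ^ 3 := by gcongr
  have hκ30 : 0 < κ ^ 3 := by positivity
  rw [le_div_iff₀ (by linarith)] at h
  rw [Real.le_log_iff_exp_le (by linarith)]
  calc Real.exp 1000 ≤ (2 * Real.exp 1000) * (1 / 2) * (κ ^ 3 + 1) := by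
        have := Real.exp_pos 1000
        nlinarith
    _ = K * (1 / 2) * κ ^ 3 := by rw [hK]; field_simp
    _ ≤ K * l * Real.log (Real.log M) ^ 3 := by
        gcongr
        linarith
    _ ≤ _ := h

/-- With `n` about `X` and `L = √(n * l)`, the identity `X * l = Λ ^ 2 / lam ^ 3` makes `L` of order
`Λ / lam ^ (3 / 2)`. The `(n * q + 1) ^ d` features fit into `ℝ^M` because `d` is about `L` and `log
(n * q + 1) ≤ 5 * lam`. -/
lemma exists_params {M : ℕ} {l X : ℝ} (hl : 0.69 ≤ l) (hlam : 1000 ≤ Real.log (Real.log M))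
    (h : 1000 * l ≤ Real.log M / Real.log (Real.log M) ^ 3)
    (hX : X = Real.log M * (Real.log M / Real.log (Real.log M) ^ 3 / l)) :
    ∃ (n q d : ℕ) (L : ℝ), 2000 ≤ n ∧ q.Prime ∧ n ≤ q ∧ (n * q + 1) ^ d ≤ M ∧ 0 ≤ L ∧
      L + 2 ≤ d ∧ L ^ 2 = n * l ∧ X ≤ n ∧ 96 * l ≤ X ∧ (0 : ℝ) < M := by
  obtain ⟨Λ, hΛdef⟩ : ∃ Λ, Λ = Real.log M := ⟨_, rfl⟩
  obtain ⟨lam, hlamdef⟩ : ∃ lam, lam = Real.log Λ := ⟨_, rfl⟩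
  rw [← hΛdef, ← hlamdef] at h hlam hX
  have hΛ0 : 0 < Λ := by
    by_contra hneg
    have : Λ = 0 := le_antisymm (not_lt.mp hneg) (hΛdef ▸ Real.log_natCast_nonneg M)
    rw [hlamdef, this, Real.log_zero] at hlam
    linarith
  have hM0 : (0 : ℝ) < M := by
    rcases Nat.eq_zero_or_pos M with h0 | h0
    · rw [hΛdef, h0] at hΛ0; simp at hΛ0
    · exact_mod_cast h0
  have hΛexp : Λ = Real.exp lam := by rw [hlamdef, Real.exp_log hΛ0]
  have hΛlam : 500 * lam ≤ Λ := by
    have := Real.quadratic_le_exp_of_nonneg (show 0 ≤ lam by linarith)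
    rw [hΛexp]
    nlinarith
  have hlam3 : 1000 ≤ lam ^ 3 := by nlinarith [sq_nonneg lam]
  have hlaml : 1 ≤ lam ^ 3 * l := by nlinarith
  have hXeq : X = Λ ^ 2 / (lam ^ 3 * l) := by rw [hX]; field_simp
  have hKX : 1000 ≤ Λ / lam ^ 3 / l := by rwa [le_div_iff₀ (by linarith)]
  have hXΛ : 1000 * Λ ≤ X := by rw [hX]; nlinarith
  have hΛl : 1000 * l ≤ Λ := h.trans (div_le_self hΛ0.le (by linarith))
  have hXΛ2 : X ≤ Λ ^ 2 := by
    rw [hXeq]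
    exact div_le_self (sq_nonneg _) hlaml
  obtain ⟨n, hnX, hnX1⟩ : ∃ n : ℕ, X ≤ n ∧ (n : ℝ) < X + 1 :=
    ⟨⌈X⌉₊, Nat.le_ceil X, Nat.ceil_lt_add_one (by linarith)⟩
  have hnX2 : (n : ℝ) ≤ 2 * X := by linarith
  have hn2' : (2000 : ℝ) ≤ n := by linarith
  have hn2 : 2000 ≤ n := by exact_mod_cast hn2'
  have hn0 : (0 : ℝ) < n := by linarith
  obtain ⟨q, hqp, hnq, hq2⟩ := Nat.exists_prime_lt_and_le_two_mul n (by omega)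
  have hnl : 0 ≤ n * l := mul_nonneg hn0.le (by linarith)
  -- A square of `lam` would suffice up to constants; the third factor `lam ≥ 1000` absorbs the
  -- constant `800`.
  have hLle : √(n * l) ≤ Λ / (20 * lam) := by
    apply Real.sqrt_le_iff.mpr
    refine ⟨by positivity, ?_⟩
    have e : 2 * X * l = 2 * Λ ^ 2 / lam ^ 3 := by
      rw [hXeq]
      field_simp
    calc (n : ℝ) * l ≤ 2 * X * l := by gcongr
      _ = 2 * Λ ^ 2 / lam ^ 3 := e
      _ ≤ (Λ / (20 * lam)) ^ 2 := by
        rw [div_pow, mul_pow, div_le_div_iff₀ (by linarith) (by positivity)]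
        have : 0 ≤ Λ ^ 2 * lam ^ 2 := by positivity
        nlinarith
  obtain ⟨d, hLd, hdL⟩ : ∃ d : ℕ, √(n * l) + 2 ≤ d ∧ (d : ℝ) < √(n * l) + 2 + 1 :=
    ⟨⌈√(n * l) + 2⌉₊, Nat.le_ceil _, Nat.ceil_lt_add_one (by positivity)⟩
  have hlognq : Real.log ((n * q + 1 : ℕ) : ℝ) ≤ 5 * lam := by
    have h1 : ((n * q + 1 : ℕ) : ℝ) ≤ Λ ^ 5 := by
      have h2 : (q : ℝ) ≤ 2 * n := by exact_mod_cast hq2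
      push_cast
      calc (n : ℝ) * q + 1 ≤ n * (2 * n) + n * n := by nlinarith
        _ = 3 * (n : ℝ) ^ 2 := by ring
        _ ≤ 3 * (2 * Λ ^ 2) ^ 2 := by
          gcongr
          linarith
        _ = 12 * Λ ^ 4 := by ring
        _ ≤ Λ * Λ ^ 4 := by
          gcongr
          linarith
        _ = _ := by ring
    calc Real.log ((n * q + 1 : ℕ) : ℝ) ≤ Real.log (Λ ^ 5) :=
          Real.log_le_log (by exact_mod_cast Nat.succ_pos _) h1
      _ = _ := by rw [Real.log_pow, hlamdef]; norm_num
  have hM : (n * q + 1) ^ d ≤ M := by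
    have h1 : (d : ℝ) * Real.log ((n * q + 1 : ℕ) : ℝ) ≤ Λ := by
      calc (d : ℝ) * Real.log ((n * q + 1 : ℕ) : ℝ) ≤ (Λ / (20 * lam) + 3) * (5 * lam) := by
            refine mul_le_mul (by linarith) hlognq (Real.log_natCast_nonneg _) (by positivity)
        _ = Λ / 4 + 15 * lam := by field_simp; ring
        _ ≤ Λ := by linarith
    have h2 : (((n * q + 1 : ℕ) : ℝ)) ^ d ≤ M := by
      rw [← Real.log_le_log_iff (by positivity) hM0, Real.log_pow, ← hΛdef]
      exact h1
    exact_mod_cast h2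
  exact ⟨n, q, d, √(n * l), hn2, hqp, hnq.le, hM, Real.sqrt_nonneg _, hLd, Real.sq_sqrt hnl, hnX,
    by linarith, hM0⟩

end MassartSQ

theorem mainTheorem1 :
    ∃ K c₀ c₁ : ℝ, 0 < K ∧ 0 < c₀ ∧ 0 < c₁ ∧
      ∀ (M : ℕ) (opt η : ℝ), 0 < opt → opt < η → η < 1 / 2 →
        K * Real.log (1 / opt) ≤ Real.log M / Real.log (Real.log M) ^ 3 →
        ∀ τ : ℝ,
          τ = (M : ℝ) ^
            (-(c₀ * (Real.log M / Real.log (Real.log M) ^ 3 / Real.log (1 / opt)))) →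
          ∀ (Ω : Type*) (_ : MeasurableSpace Ω) (μ : Measure Ω) (_ : IsProbabilityMeasure μ)
            (A : Ω → SQAlgorithm M) (q : ℕ), (q : ℝ) ≤ 1 / τ →
            (∀ ω, (A ω).QueriesAtMost q) →
            ¬ LearnsMassartHalfspaces μ A η opt τ (c₁ * η) := by
  obtain ⟨K, hK, hKM⟩ := MassartSQ.exists_const_of_log_le
  -- With `c₀ = 1 / 16`, `τ = exp (-X / 16)`, which matches the bound `exp (-(n / 16)) ≤ τ` because
  -- `X ≤ n`.
  refine ⟨K, 1 / 16, 1 / 32, by linarith, by norm_num, by norm_num, ?_⟩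
  intro M opt η hopt hoptη hη h τ hτ Ω _ μ _ A Q hQ hA
  have hl : Real.log 2 ≤ Real.log (1 / opt) := by
    apply Real.log_le_log (by norm_num)
    rw [le_div_iff₀ hopt]
    linarith
  have hoptl : opt = Real.exp (-Real.log (1 / opt)) := by
    rw [one_div, Real.log_inv, neg_neg, Real.exp_log hopt]
  have hlam := hKM M _ hl h
  have hl0 : 0.69 ≤ Real.log (1 / opt) := by linarith [Real.log_two_gt_d9]
  obtain ⟨n, q, d, L, hn, hqp, hnq, hM, hL0, hLd, hL2, hXn, hX, hM0⟩ :=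
    MassartSQ.exists_params hl0 hlam (by nlinarith) rfl
  generalize Real.log (1 / opt) = l at *
  have hτX : τ = Real.exp (-(Real.log M * (Real.log M / Real.log (Real.log M) ^ 3 / l) / 16)) := by
    rw [hτ, Real.rpow_def_of_pos hM0]
    congr 1
    ring
  have : Fact q.Prime := ⟨hqp⟩
  have hn0 : (0 : ℝ) < n := by exact_mod_cast (by omega : 0 < n)
  refine MassartSQ.not_learns hn hnq hM hL0 hLd ?_ (hopt.trans hoptη) hη ?_ ?_ μ A hQ hA
  -- The tail bound is `2 * opt ^ 2`, which is at most `opt` since `opt < 1 / 2`.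
  · have h1 : 2 * L ^ 2 / n = l + l := by
      rw [hL2]
      field_simp
      ring
    rw [h1, neg_add, Real.exp_add, ← hoptl]
    nlinarith
  · rw [hτX, Real.exp_le_exp]
    linarith
  -- From `96 * l ≤ X`; five of the factors `opt < 1 / 2` supply the `1 / 32` in `τ ≤ η / 32`.
  · have h1 : τ ≤ opt ^ 6 := by
      rw [hτX, hoptl, ← Real.exp_nat_mul, Real.exp_le_exp]
      push_cast
      linarith
    have h2 : opt ^ 5 ≤ (1 / 2) ^ 5 := by
      gcongr
      linarith
    have h3 : opt ^ 6 = opt * opt ^ 5 := by ring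
    nlinarith
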